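/- Let $N$ be a natural number and let $Q,B$ be real constant $N\times N$ matrices with $Q=Q^\star\ge 0$. On $\mathbb R^{N+1}=\mathbb R^N\times\mathbb R\ni (X,t)$ put $$\mathscr A u=\operatorname{tr}(Q\nabla_X^2u)+\langle BX,\nabla_X u\rangle,\qquad \mathscr K u=\mathscr A u-\partial_t u,\qquad K(t)=\frac1t\int_0^t e^{\sigma B}Qe^{\sigma B^\star}\,d\sigma ,$$ and assume Hörmander's condition that $K(t)$ is positive definite for every $t>0$ (no condition on the sign of $\operatorname{tr}B$ is imposed). For $X,Y\in\mathbb R^N$ and $t>0$ let $$p(X,Y,t)=(4\pi)^{-N/2}\bigl(\det (tK(t))\bigr)^{-1/2}\exp\Bigl(-\frac{\langle K(t)^{-1}(Y-e^{tB}X),\,Y-e^{tB}X\rangle}{4t}\Bigr).$$ For $u\in\mathscr S(\mathbb R^{N+1})$ (real or complex valued) and $\tau>0$ let $P^{\mathscr K}_\tau u(X,t)=\int_{\mathbb R^N}p(X,Y,\tau)\,u(Y,t-\tau)\,dY$, and for $0<s<1$ let $$(-\mathscr K)^su(X,t)=-\frac{s}{\Gamma(1-s)}\int_0^\infty \tau^{-1-s}\bigl[P^{\mathscr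 K}_\tau u(X,t)-u(X,t)\bigr]\,d\tau .$$ Let $0<s<1$, $a=1-2s$, and for $z,t>0$ let $$P_z^{(a)}(X,Y,t)=g^{(a)}(z,t)\,p(X,Y,t),\qquad g^{(a)}(z,t)=\frac{1}{2^{1-a}\Gamma(\frac{1-a}2)}\,\frac{z^{1-a}}{t^{\frac{3-a}2}}\,e^{-\frac{z^2}{4t}} .$$ Given $u\in\mathscr S(\mathbb R^{N+1})$, define for $(X,t)\in\mathbb R^{N+1}$, $z>0$, $$U(X,t,z)=\int_{-\infty}^t\int_{\mathbb R^N}P^{(a)}_z(X,Y,t-\tau)\,u(Y,\tau)\,dY\,d\tau=\int_0^\infty\int_{\mathbb R^N}P^{(a)}_z(X,Y,\tau)\,u(Y,t-\tau)\,dY\,d\tau .$$ Then all the integrals above converge absolutely, the two expressions for $U$ agree, and: 1. $U\in C^\infty(\mathbb R^{N+1}\times(0,\infty))$; 2. $\mathscr K_aU:=z^a\bigl(\mathscr K+\partial_{zz}+\frac az\partial_z\bigr)U=0$ in $\mathbb R^{N+1}\times(0,\infty)$; 3. $U(\cdot,\cdot,z)\in L^\infty(\mathbb R^{N+1})$ for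 every $z>0$, and $\displaystyle\lim_{z\to0^+}\|U(\cdot,\cdot,z)-u\|_{L^\infty(\mathbb R^{N+1})}=0$; 4. $(-\mathscr K)^su\in L^\infty(\mathbb R^{N+1})$, $z^a\partial_zU(\cdot,\cdot,z)\in L^\infty(\mathbb R^{N+1})$ for every $z>0$, and $$\lim_{z\to0^+}\Bigl\|-\frac{2^{-a}\Gamma(\frac{1-a}2)}{\Gamma(\frac{1+a}2)}\,z^a\,\partial_zU(\cdot,\cdot,z)-(-\mathscr K)^su\Bigr\|_{L^\infty(\mathbb R^{N+1})}=0 .$$ -/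

import Mathlib

open MeasureTheory Set Filter
open scoped Topology ContDiff ENNReal Matrix SchwartzMap

noncomputable section

namespace Hormander

/-- The space `ℝ^N` with its Euclidean structure. -/
abbrev Space (N : ℕ) : Type := EuclideanSpace ℝ (Fin N)

variable {N : ℕ} {𝕜 : Type*} [RCLike 𝕜]

/-- The covariance matrix `K(t) = (1/t) ∫₀ᵗ e^{σB} Q e^{σB*} dσ`, the matrix-valued integral being
taken entry by entry. -/
def covariance (Q B : Matrix (Fin N) (Fin N) ℝ) (t : ℝ) : Matrix (Fin N) (Fin N) ℝ :=
  Matrix.of fun i j =>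
    (1 / t) * ∫ σ in (0 : ℝ)..t, (NormedSpace.exp (σ • B) * Q * NormedSpace.exp (σ • Bᵀ)) i j

/-- Hörmander's transition kernel
`p(X,Y,t) = (4π)^{-N/2} det(t K(t))^{-1/2} exp(-⟨K(t)⁻¹(Y - e^{tB}X), Y - e^{tB}X⟩ / (4t))`. -/
def kernel (Q B : Matrix (Fin N) (Fin N) ℝ) (X Y : Space N) (t : ℝ) : ℝ :=
  (4 * Real.pi) ^ (-(N : ℝ) / 2) * (t • covariance Q B t).det ^ (-(1 / 2) : ℝ) *
    Real.exp (-(((covariance Q B t)⁻¹ *ᵥ (Y.ofLp - NormedSpace.exp (t • B) *ᵥ X.ofLp)) ⬝ᵥ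
      (Y.ofLp - NormedSpace.exp (t • B) *ᵥ X.ofLp)) / (4 * t))

/-- The evolutive Hörmander semigroup `P^𝒦_τ u(X,t) = ∫ p(X,Y,τ) u(Y,t-τ) dY`. -/
def evolutiveSemigroup (Q B : Matrix (Fin N) (Fin N) ℝ) (τ : ℝ) (u : Space N × ℝ → 𝕜)
    (X : Space N) (t : ℝ) : 𝕜 :=
  ∫ Y : Space N, kernel Q B X Y τ • u (Y, t - τ)

/-- Balakrishnan's formula for the fractional power
`(-𝒦)^s u(X,t) = -(s / Γ(1-s)) ∫₀^∞ τ^{-1-s} [P^𝒦_τ u(X,t) - u(X,t)] dτ`. -/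
def fracPower (Q B : Matrix (Fin N) (Fin N) ℝ) (s : ℝ) (u : Space N × ℝ → 𝕜)
    (X : Space N) (t : ℝ) : 𝕜 :=
  (-(s / Real.Gamma (1 - s))) •
    ∫ τ in Ioi (0 : ℝ), τ ^ (-1 - s) • (evolutiveSemigroup Q B τ u X t - u (X, t))

/-- `g^{(a)}(z,t) = z^{1-a} t^{-(3-a)/2} e^{-z²/(4t)} / (2^{1-a} Γ((1-a)/2))`. -/
def besselKernel (a z t : ℝ) : ℝ :=
  1 / ((2 : ℝ) ^ (1 - a) * Real.Gamma ((1 - a) / 2)) * (z ^ (1 - a) / t ^ ((3 - a) / 2)) *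
    Real.exp (-z ^ 2 / (4 * t))

/-- The Poisson kernel `P^{(a)}_z(X,Y,t) = g^{(a)}(z,t) p(X,Y,t)`. -/
def poissonKernel (Q B : Matrix (Fin N) (Fin N) ℝ) (a z : ℝ) (X Y : Space N) (t : ℝ) : ℝ :=
  besselKernel a z t * kernel Q B X Y t

/-- The extension `U(X,t,z) = ∫_{-∞}^t ∫ P^{(a)}_z(X,Y,t-τ) u(Y,τ) dY dτ`. -/
def extension (Q B : Matrix (Fin N) (Fin N) ℝ) (a : ℝ) (u : Space N × ℝ → 𝕜)
    (X : Space N) (t z : ℝ) : 𝕜 :=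
  ∫ τ in Iio t, ∫ Y : Space N, poissonKernel Q B a z X Y (t - τ) • u (Y, τ)

/-- The partial derivative of `f` in the `i`-th coordinate of `ℝ^N`. -/
def partialDeriv (i : Fin N) (f : Space N → 𝕜) (X : Space N) : 𝕜 :=
  lineDeriv ℝ f X (EuclideanSpace.single i 1)

/-- `𝒜 f = tr(Q ∇² f) + ⟨BX, ∇f⟩`. -/
def diffusionOp (Q B : Matrix (Fin N) (Fin N) ℝ) (f : Space N → 𝕜) (X : Space N) : 𝕜 :=
  (∑ i, ∑ j, Q i j • partialDeriv j (partialDeriv i f) X) +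
    ∑ i, (B *ᵥ X.ofLp) i • partialDeriv i f X

/-- `𝒦 v = 𝒜 v - ∂_t v`. -/
def hormanderOp (Q B : Matrix (Fin N) (Fin N) ℝ) (v : Space N → ℝ → 𝕜)
    (X : Space N) (t : ℝ) : 𝕜 :=
  diffusionOp Q B (fun X' => v X' t) X - deriv (fun t' => v X t') t

/-- The Bessel operator `∂_zz + (a/z) ∂_z`. -/
def besselOp (a : ℝ) (f : ℝ → 𝕜) (z : ℝ) : 𝕜 :=
  deriv (deriv f) z + (a / z) • deriv f z

/-- The extension operator `𝒦_a = z^a (𝒦 + ∂_zz + (a/z) ∂_z)`. -/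
def extensionOp (Q B : Matrix (Fin N) (Fin N) ℝ) (a : ℝ) (V : Space N → ℝ → ℝ → 𝕜)
    (X : Space N) (t z : ℝ) : 𝕜 :=
  z ^ a • (hormanderOp Q B (fun X' t' => V X' t' z) X t + besselOp a (fun z' => V X t z') z)

/-- The weighted normal derivative `-(2^{-a} Γ((1-a)/2) / Γ((1+a)/2)) z^a ∂_z V(X,t,z)`. -/
def neumannData (a : ℝ) (V : Space N → ℝ → ℝ → 𝕜) (X : Space N) (t z : ℝ) : 𝕜 :=
  (-((2 : ℝ) ^ (-a) * Real.Gamma ((1 - a) / 2) / Real.Gamma ((1 + a) / 2)) * z ^ a) •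
    deriv (fun z' => V X t z') z

end Hormander

end

/-! Everything is computed on plane waves. The kernel `p(X,·,τ)` is a Gaussian density with mean
`e^{τB}X` and covariance matrix `2τK(τ)`. Hence `P_τ` sends `e^{2πi(⟨ξ,Y⟩+θr)}` to a multiple of a
plane wave: the frequency `ξ` becomes `e^{τB*}ξ`, the time `t` becomes `t-τ`, and a damping factor
`e^{-4π²⟨τK(τ)ξ,ξ⟩}` appears (`integral_kernel_mul_wave`). Fourier inversion writes `u` as a
superposition of plane waves whose density `f` has all moments, and so represents `P_τ u`
(`evolutiveSemigroup_eq`).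

With `w = z²/4`, `U` is a constant times `z^{2s} ∫ τ^{-1-s} e^{-w/τ} P_τ u dτ`. Apart from the
prefactor, this is a superposition over `(τ,ξ,θ)` of exponentials of linear functions of `(X,t,w)`.
A derivative multiplies the amplitude by a linear function of `(e^{τB*}ξ, θ, 1/τ)`, so smoothness is
a question of moments (`expIntegrable_freq`). Since `B` is arbitrary, `e^{τB*}ξ` may grow
exponentially in `τ`. But positivity of `K(1)` and the group law give `⟨τK(τ)ξ,ξ⟩ ≥ κ‖e^{τB*}ξ‖²`
for `τ ≥ 1`, and the damping absorbs the growth. Powers of `1/τ` are absorbed by `e^{-w/τ}`.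

After the factor `z^{2s}` is removed, the Bessel operator becomes `w∂_ww + (s+1)∂_w`. It acts on
`τ^{-1-s}e^{-w/τ}` as `∂_τ`, and `𝒦` acts on the symbol as `∂_τ`. Their sum turns the integrand into
a total `τ`-derivative with vanishing boundary values, whence `𝒦_a U = 0` (`expIntegral_equation`).

At the boundary the key estimate is `|P_τ u - u| ≤ C min(τ,1)`, uniformly in `(X,t)`
(`exists_norm_semigroup_sub_le`). As `g^{(a)}(z,·)` has mass one and its `z`-derivative has mass
zero, both `U - u` and the Neumann data are weighted averages of `P_τ u - u` against `τ^{-1-s}`. The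
weight of the first is `O(z^{2s})`; that of the second is bounded and tends to `1`, which yields
Balakrishnan's integral. -/

noncomputable section

namespace Hormander

/-! ### Gaussian densities and their characteristic functions -/

section Gaussian

variable {N : ℕ}

-- The substitution `y = Sx` with a symmetric root `S` of the covariance reduces Gaussian integrals
-- to the standard one.
open scoped MatrixOrder in
lemma exists_symm_sqrt {C : Matrix (Fin N) (Fin N) ℝ} (hC : C.PosDef) :
    ∃ S : Matrix (Fin N) (Fin N) ℝ, Sᵀ = S ∧ S * S = C ∧ S.det ≠ 0 := by
  refine ⟨CFC.sqrt C, ?_, CFC.sqrt_mul_sqrt_self C hC.posSemidef.nonneg, ?_⟩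
  · have h := (CFC.sqrt_nonneg C).isSelfAdjoint
    rw [isSelfAdjoint_iff, Matrix.star_eq_conjTranspose] at h
    simpa using h
  · intro h0
    have h := congrArg Matrix.det (CFC.sqrt_mul_sqrt_self C hC.posSemidef.nonneg)
    rw [Matrix.det_mul, h0] at h
    exact hC.det_pos.ne' (by simpa using h.symm)

lemma toEuclideanCLM_measurableEmbedding {S : Matrix (Fin N) (Fin N) ℝ} (hS : S.det ≠ 0) :
    MeasurableEmbedding (Matrix.toEuclideanCLM (𝕜 := ℝ) S : Space N → Space N) ∧
      Measure.map (Matrix.toEuclideanCLM (𝕜 := ℝ) S : Space N → Space N) volume =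
        ENNReal.ofReal |(S.det)⁻¹| • volume := by
  have hdet : LinearMap.det (Matrix.toEuclideanCLM (𝕜 := ℝ) S : Space N →ₗ[ℝ] Space N) =
      S.det := by
    rw [Matrix.coe_toEuclideanCLM_eq_toEuclideanLin, Matrix.toEuclideanLin,
      Matrix.toLpLin_eq_toLin, LinearMap.det_toLin]
  have hinj : Function.Injective (Matrix.toEuclideanCLM (𝕜 := ℝ) S : Space N → Space N) :=
    (LinearMap.equivOfDetNeZero
      (Matrix.toEuclideanCLM (𝕜 := ℝ) S : Space N →ₗ[ℝ] Space N) (by rwa [hdet])).injective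
  refine ⟨(ContinuousLinearMap.continuous _).measurableEmbedding hinj, ?_⟩
  have hmap := Measure.map_linearMap_addHaar_eq_smul_addHaar (volume : Measure (Space N))
    (f := (Matrix.toEuclideanCLM (𝕜 := ℝ) S : Space N →ₗ[ℝ] Space N)) (by rwa [hdet])
  rwa [hdet] at hmap

/-- Linear change of variables on `ℝ^N`. -/
lemma integral_eq_abs_det_smul {S : Matrix (Fin N) (Fin N) ℝ} (hS : S.det ≠ 0)
    (F : Space N → ℂ) :
    ∫ y, F y = |S.det| • ∫ x, F (Matrix.toEuclideanCLM (𝕜 := ℝ) S x) := by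
  obtain ⟨hemb, hmap⟩ := toEuclideanCLM_measurableEmbedding hS
  have h := hemb.integral_map (μ := (volume : Measure (Space N))) F
  rw [hmap, integral_smul_measure] at h
  rw [← h, ENNReal.toReal_ofReal (abs_nonneg _), smul_smul, abs_inv,
    mul_inv_cancel₀ (abs_ne_zero.2 hS), one_smul]

lemma integrable_of_comp_toEuclideanCLM {S : Matrix (Fin N) (Fin N) ℝ} (hS : S.det ≠ 0)
    {F : Space N → ℂ}
    (hF : Integrable (fun x => F (Matrix.toEuclideanCLM (𝕜 := ℝ) S x))) : Integrable F := by
  obtain ⟨hemb, hmap⟩ := toEuclideanCLM_measurableEmbedding hS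
  have h := (hemb.integrable_map_iff (μ := (volume : Measure (Space N))) (g := F)).2 hF
  rw [hmap] at h
  exact (integrable_smul_measure (by simpa using hS) (by simp)).1 h

/-- The centred Gaussian density with covariance matrix `2C`. -/
def gaussianDensity (C : Matrix (Fin N) (Fin N) ℝ) (y : Space N) : ℝ :=
  (4 * Real.pi) ^ (-(N : ℝ) / 2) * C.det ^ (-(1 / 2) : ℝ) *
    Real.exp (-((C⁻¹ *ᵥ y.ofLp) ⬝ᵥ y.ofLp) / 4)

lemma gaussianDensity_nonneg {C : Matrix (Fin N) (Fin N) ℝ} (hC : C.PosDef) (y : Space N) :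
    0 ≤ gaussianDensity C y := by
  have := hC.det_pos
  have := Real.pi_pos
  unfold gaussianDensity
  positivity

/-- Since `S C⁻¹ S = 1`, the quadratic form becomes `‖x‖²`, while symmetry of `S` moves it onto the
frequency in the phase. -/
lemma gaussianDensity_comp {C S : Matrix (Fin N) (Fin N) ℝ} (hS : Sᵀ = S) (hSC : S * S = C)
    (hdet : S.det ≠ 0) (ξ x : Space N) :
    (gaussianDensity C (Matrix.toEuclideanCLM (𝕜 := ℝ) S x) : ℂ) *
      Complex.exp (2 * Real.pi * Complex.I *
        (inner ℝ ξ (Matrix.toEuclideanCLM (𝕜 := ℝ) S x) : ℝ)) =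
    ((4 * Real.pi) ^ (-(N : ℝ) / 2) * C.det ^ (-(1 / 2) : ℝ) : ℝ) *
      Complex.exp (-(1 / 4) * (‖x‖ : ℂ) ^ 2 + 2 * Real.pi * Complex.I *
        (inner ℝ (Matrix.toEuclideanCLM (𝕜 := ℝ) S ξ) x : ℝ)) := by
  have hq : (C⁻¹ *ᵥ (S *ᵥ x.ofLp)) ⬝ᵥ (S *ᵥ x.ofLp) = ‖x‖ ^ 2 := by
    have hunit : IsUnit S.det := isUnit_iff_ne_zero.2 hdet
    rw [← hSC, Matrix.mul_inv_rev, Matrix.mulVec_mulVec, Matrix.mul_assoc,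
      Matrix.nonsing_inv_mul _ hunit, Matrix.mul_one, Matrix.dotProduct_mulVec,
      ← Matrix.mulVec_transpose, hS, Matrix.mulVec_mulVec, Matrix.mul_nonsing_inv _ hunit,
      Matrix.one_mulVec, EuclideanSpace.real_norm_sq_eq]
    simp [dotProduct, sq]
  have hi : inner ℝ ξ (Matrix.toEuclideanCLM (𝕜 := ℝ) S x) =
      inner ℝ (Matrix.toEuclideanCLM (𝕜 := ℝ) S ξ) x := by
    rw [Matrix.inner_toEuclideanCLM, real_inner_comm, Matrix.inner_toEuclideanCLM,
      Matrix.dotProduct_mulVec, ← Matrix.mulVec_transpose, hS, dotProduct_comm]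
  rw [gaussianDensity, Matrix.ofLp_toEuclideanCLM, hq, hi, Complex.exp_add]
  push_cast
  ring_nf

lemma integrable_gaussianDensity_mul {C : Matrix (Fin N) (Fin N) ℝ} (hC : C.PosDef)
    (ξ : Space N) :
    Integrable (fun y : Space N => (gaussianDensity C y : ℂ) *
      Complex.exp (2 * Real.pi * Complex.I * (inner ℝ ξ y : ℝ))) := by
  obtain ⟨S, hS, hSC, hdet⟩ := exists_symm_sqrt hC
  apply integrable_of_comp_toEuclideanCLM hdet
  simp_rw [gaussianDensity_comp hS hSC hdet]
  exact (GaussianFourier.integrable_cexp_neg_mul_sq_norm_add (b := 1 / 4) (by norm_num) _ _).const_mul _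

lemma integrable_gaussianDensity {C : Matrix (Fin N) (Fin N) ℝ} (hC : C.PosDef) :
    Integrable (gaussianDensity C) := by
  have := (integrable_gaussianDensity_mul hC 0).re
  simpa using this

/-- The characteristic function of the centred Gaussian density. -/
lemma integral_gaussianDensity_mul {C : Matrix (Fin N) (Fin N) ℝ} (hC : C.PosDef)
    (ξ : Space N) :
    ∫ y : Space N, (gaussianDensity C y : ℂ) *
      Complex.exp (2 * Real.pi * Complex.I * (inner ℝ ξ y : ℝ)) =
    Complex.exp (-(4 * Real.pi ^ 2 * (ξ.ofLp ⬝ᵥ C *ᵥ ξ.ofLp) : ℝ)) := by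
  obtain ⟨S, hS, hSC, hdet⟩ := exists_symm_sqrt hC
  rw [integral_eq_abs_det_smul hdet]
  simp_rw [gaussianDensity_comp hS hSC hdet]
  rw [integral_const_mul, GaussianFourier.integral_cexp_neg_mul_sq_norm_add (b := 1 / 4)
    (by norm_num)]
  have hn : ‖Matrix.toEuclideanCLM (𝕜 := ℝ) S ξ‖ ^ 2 = ξ.ofLp ⬝ᵥ C *ᵥ ξ.ofLp := by
    rw [← real_inner_self_eq_norm_sq, Matrix.inner_toEuclideanCLM, Matrix.ofLp_toEuclideanCLM,
      ← hSC, ← Matrix.mulVec_mulVec, Matrix.dotProduct_mulVec _ S (S *ᵥ _),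
      ← Matrix.mulVec_transpose, hS]
  -- The normalising determinant cancels the Jacobian `|det S|`; likewise `(4π)^{-N/2}` cancels the
  -- value of the standard Gaussian integral.
  have hd : C.det ^ (-(1 / 2) : ℝ) = |S.det|⁻¹ := by
    rw [← hSC, Matrix.det_mul, ← abs_mul_abs_self, ← sq, ← Real.rpow_natCast, ← Real.rpow_mul
      (abs_nonneg _), ← Real.rpow_neg_one]
    norm_num
  have hpi : ((Real.pi : ℂ) / (1 / 4)) ^ ((Module.finrank ℝ (Space N) : ℂ) / 2) =
      (((4 * Real.pi) ^ ((N : ℝ) / 2) : ℝ) : ℂ) := by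
    rw [Complex.ofReal_cpow (by positivity)]
    simp [mul_comm]
  rw [hpi, hd, ← Complex.ofReal_pow, hn, neg_div, Real.rpow_neg (by positivity)]
  have h1 : (4 * Real.pi) ^ ((N : ℝ) / 2) ≠ 0 := by positivity
  have h2 : |S.det| ≠ 0 := abs_ne_zero.2 hdet
  rw [Complex.real_smul, ← mul_assoc, ← mul_assoc, ← Complex.ofReal_mul, ← Complex.ofReal_mul]
  rw [show |S.det| * (((4 * Real.pi) ^ ((N : ℝ) / 2))⁻¹ * |S.det|⁻¹) * (4 * Real.pi) ^ ((N : ℝ) / 2)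
    = 1 by field_simp]
  rw [Complex.ofReal_one, one_mul]
  congr 1
  push_cast
  ring_nf
  simp

lemma integral_gaussianDensity {C : Matrix (Fin N) (Fin N) ℝ} (hC : C.PosDef) :
    ∫ y, gaussianDensity C y = 1 := by
  have h := integral_gaussianDensity_mul hC 0
  simp only [inner_zero_left, Complex.ofReal_zero, mul_zero, Complex.exp_zero, mul_one,
    WithLp.ofLp_zero, zero_dotProduct, neg_zero] at h
  rw [integral_complex_ofReal] at h
  exact_mod_cast h

end Gaussian

/-! ### The flow `e^{τB*}` and the quadratic form of `τK(τ)` -/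

section Flow

variable {N : ℕ}

/-- The operator on `ℝ^N` given by a matrix. -/
def matOp (A : Matrix (Fin N) (Fin N) ℝ) : Space N →L[ℝ] Space N :=
  Matrix.toEuclideanCLM (𝕜 := ℝ) A

lemma ofLp_matOp (A : Matrix (Fin N) (Fin N) ℝ) (x : Space N) :
    (matOp A x).ofLp = A *ᵥ x.ofLp := rfl

lemma inner_matOp (A : Matrix (Fin N) (Fin N) ℝ) (x y : Space N) :
    inner ℝ x (matOp A y) = x.ofLp ⬝ᵥ A *ᵥ y.ofLp :=
  Matrix.inner_toEuclideanCLM A x y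

lemma inner_matOp_transpose (A : Matrix (Fin N) (Fin N) ℝ) (x y : Space N) :
    inner ℝ x (matOp A y) = inner ℝ (matOp Aᵀ x) y := by
  rw [real_inner_comm y, inner_matOp, inner_matOp,
    Matrix.dotProduct_mulVec, ← Matrix.mulVec_transpose, dotProduct_comm]

lemma matOp_smul (r : ℝ) (A : Matrix (Fin N) (Fin N) ℝ) : matOp (r • A) = r • matOp A := by
  ext x i
  simp [ofLp_matOp, Matrix.smul_mulVec]

/-- The one-parameter group generated by a bounded operator. -/
def expGroup {E : Type*} [NormedAddCommGroup E] [NormedSpace ℝ E] (A : E →L[ℝ] E) (τ : ℝ) :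
    E →L[ℝ] E :=
  NormedSpace.exp (τ • A)

lemma expGroup_zero {E : Type*} [NormedAddCommGroup E] [NormedSpace ℝ E] (A : E →L[ℝ] E) :
    expGroup A 0 = 1 := by
  rw [expGroup, zero_smul, NormedSpace.exp_zero]

lemma expGroup_add {E : Type*} [NormedAddCommGroup E] [NormedSpace ℝ E] [CompleteSpace E]
    (A : E →L[ℝ] E) (σ τ : ℝ) : expGroup A (σ + τ) = expGroup A σ * expGroup A τ := by
  let _ : NormedAlgebra ℚ (E →L[ℝ] E) := NormedAlgebra.restrictScalars ℚ ℝ _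
  rw [expGroup, add_smul, NormedSpace.exp_add_of_commute]
  · rfl
  · exact ((Commute.refl _).smul_left _).smul_right _

/-- The flow `e^{τB*}` as an operator on `ℝ^N`. -/
def flow (B : Matrix (Fin N) (Fin N) ℝ) : ℝ → Space N →L[ℝ] Space N :=
  expGroup (matOp Bᵀ)

lemma hasDerivAt_flow (B : Matrix (Fin N) (Fin N) ℝ) (τ : ℝ) :
    HasDerivAt (flow B) (matOp Bᵀ * flow B τ) τ :=
  hasDerivAt_exp_smul_const' (𝕂 := ℝ) (matOp Bᵀ) τ

lemma continuous_flow (B : Matrix (Fin N) (Fin N) ℝ) : Continuous (flow B) :=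
  continuous_iff_continuousAt.2 fun τ => (hasDerivAt_flow B τ).continuousAt

@[simp]
lemma flow_zero (B : Matrix (Fin N) (Fin N) ℝ) : flow B 0 = 1 := expGroup_zero _

lemma flow_add (B : Matrix (Fin N) (Fin N) ℝ) (σ τ : ℝ) :
    flow B (σ + τ) = flow B σ * flow B τ := expGroup_add _ _ _

open scoped Matrix.Norms.Operator in
lemma continuous_exp_smul (B : Matrix (Fin N) (Fin N) ℝ) :
    Continuous fun τ : ℝ => NormedSpace.exp (τ • B) := by
  have : ∀ τ, HasDerivAt (fun τ : ℝ => NormedSpace.exp (τ • B)) _ τ :=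
    fun τ => hasDerivAt_exp_smul_const' B τ
  exact continuous_iff_continuousAt.2 fun τ => (this τ).continuousAt

open scoped Matrix.Norms.Operator in
lemma matOp_exp (B : Matrix (Fin N) (Fin N) ℝ) :
    matOp (NormedSpace.exp B) = NormedSpace.exp (matOp B) := by
  have hc : Continuous (Matrix.toEuclideanCLM (𝕜 := ℝ) (n := Fin N)) :=
    LinearMap.continuous_of_finiteDimensional
      ((Matrix.toEuclideanCLM (𝕜 := ℝ) (n := Fin N)).toAlgEquiv.toLinearMap)
  exact NormedSpace.map_exp (Matrix.toEuclideanCLM (𝕜 := ℝ) (n := Fin N)) hc B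

lemma matOp_exp_transpose (B : Matrix (Fin N) (Fin N) ℝ) (τ : ℝ) :
    matOp (NormedSpace.exp (τ • Bᵀ)) = flow B τ := by
  rw [matOp_exp, matOp_smul, flow, expGroup]

lemma ofLp_flow (B : Matrix (Fin N) (Fin N) ℝ) (τ : ℝ) (ξ : Space N) :
    (flow B τ ξ).ofLp = NormedSpace.exp (τ • Bᵀ) *ᵥ ξ.ofLp := by
  rw [← matOp_exp_transpose, ofLp_matOp]

lemma exp_smul_transpose (B : Matrix (Fin N) (Fin N) ℝ) (τ : ℝ) :
    NormedSpace.exp (τ • Bᵀ) = (NormedSpace.exp (τ • B))ᵀ := by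
  rw [← Matrix.exp_transpose, Matrix.transpose_smul]

/-- Moving the drift `e^{τB}` of the mean onto the frequency is the reason for working with the
adjoint flow. -/
lemma inner_exp_smul (B : Matrix (Fin N) (Fin N) ℝ) (τ : ℝ) (ξ X : Space N) :
    inner ℝ ξ (matOp (NormedSpace.exp (τ • B)) X) =
      inner ℝ (flow B τ ξ) X := by
  rw [inner_matOp_transpose, ← exp_smul_transpose, matOp_exp_transpose]

/-- The quadratic form of `Q`. -/
def qform (Q : Matrix (Fin N) (Fin N) ℝ) (x : Space N) : ℝ := x.ofLp ⬝ᵥ Q *ᵥ x.ofLp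

lemma qform_eq_inner (Q : Matrix (Fin N) (Fin N) ℝ) (x : Space N) :
    qform Q x = inner ℝ x (matOp Q x) := by
  rw [inner_matOp, qform]

lemma qform_nonneg {Q : Matrix (Fin N) (Fin N) ℝ} (hQ : Q.PosSemidef) (x : Space N) :
    0 ≤ qform Q x := by
  simpa [qform] using hQ.dotProduct_mulVec_nonneg x.ofLp

@[fun_prop]
lemma continuous_qform (Q : Matrix (Fin N) (Fin N) ℝ) : Continuous (qform Q) := by
  simp_rw [funext (qform_eq_inner Q)]
  fun_prop

lemma abs_qform_le (Q : Matrix (Fin N) (Fin N) ℝ) (x : Space N) :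
    |qform Q x| ≤ ‖matOp Q‖ * ‖x‖ ^ 2 := by
  rw [qform_eq_inner]
  refine (abs_real_inner_le_norm _ _).trans ?_
  have := (matOp Q).le_opNorm x
  nlinarith [norm_nonneg x]

/-- The quadratic form `⟨τ K(τ) ξ, ξ⟩ = ∫₀^τ ⟨Q e^{σB*}ξ, e^{σB*}ξ⟩ dσ`. -/
def accum (Q B : Matrix (Fin N) (Fin N) ℝ) (τ : ℝ) (ξ : Space N) : ℝ :=
  ∫ σ in (0 : ℝ)..τ, qform Q (flow B σ ξ)

lemma continuous_qform_flow (Q B : Matrix (Fin N) (Fin N) ℝ) :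
    Continuous fun p : Space N × ℝ => qform Q (flow B p.2 p.1) := by
  have h := continuous_flow B
  fun_prop

lemma continuous_accum (Q B : Matrix (Fin N) (Fin N) ℝ) :
    Continuous fun p : ℝ × Space N => accum Q B p.1 p.2 := by
  have h : Continuous (Function.uncurry fun (p : ℝ × Space N) (σ : ℝ) =>
      qform Q (flow B σ p.2)) :=
    (continuous_qform_flow Q B).comp (by fun_prop : Continuous fun p : (ℝ × Space N) × ℝ =>
      (p.1.2, p.2))
  exact intervalIntegral.continuous_parametric_intervalIntegral_of_continuous h continuous_fst

lemma hasDerivAt_accum (Q B : Matrix (Fin N) (Fin N) ℝ) (ξ : Space N) (τ : ℝ) :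
    HasDerivAt (fun τ => accum Q B τ ξ) (qform Q (flow B τ ξ)) τ := by
  have h : Continuous fun σ => qform Q (flow B σ ξ) :=
    (continuous_qform_flow Q B).comp (by fun_prop : Continuous fun σ : ℝ => (ξ, σ))
  exact h.integral_hasStrictDerivAt 0 τ |>.hasDerivAt

lemma accum_nonneg {Q : Matrix (Fin N) (Fin N) ℝ} (hQ : Q.PosSemidef)
    (B : Matrix (Fin N) (Fin N) ℝ) {τ : ℝ} (hτ : 0 ≤ τ) (ξ : Space N) : 0 ≤ accum Q B τ ξ :=
  intervalIntegral.integral_nonneg hτ fun _ _ => qform_nonneg hQ _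

/-- The matrix `t K(t)`. -/
lemma smul_covariance (Q B : Matrix (Fin N) (Fin N) ℝ) {t : ℝ} (ht : t ≠ 0) :
    t • covariance Q B t = Matrix.of fun i j =>
      ∫ σ in (0 : ℝ)..t, (NormedSpace.exp (σ • B) * Q * NormedSpace.exp (σ • Bᵀ)) i j := by
  ext i j
  simp [covariance, ht]

lemma continuous_expConj (Q B : Matrix (Fin N) (Fin N) ℝ) : Continuous fun σ : ℝ =>
    NormedSpace.exp (σ • B) * Q * NormedSpace.exp (σ • Bᵀ) :=
  ((continuous_exp_smul B).mul continuous_const).mul (continuous_exp_smul Bᵀ)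

/-- This links the entrywise integral defining `K(t)` to a scalar integral along the flow, which can
be differentiated and estimated directly. -/
lemma dotProduct_covariance (Q B : Matrix (Fin N) (Fin N) ℝ) {t : ℝ} (ht : t ≠ 0) (ξ : Space N) :
    ξ.ofLp ⬝ᵥ (t • covariance Q B t) *ᵥ ξ.ofLp = accum Q B t ξ := by
  have hc := continuous_expConj Q B
  have hcij (i j) : IntervalIntegrable (fun σ : ℝ =>
      (NormedSpace.exp (σ • B) * Q * NormedSpace.exp (σ • Bᵀ)) i j) volume 0 t :=
    (hc.matrix_elem i j).intervalIntegrable _ _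
  have hq (σ : ℝ) : qform Q (flow B σ ξ) = ∑ i, ∑ j, ξ.ofLp i *
      ((NormedSpace.exp (σ • B) * Q * NormedSpace.exp (σ • Bᵀ)) i j * ξ.ofLp j) := by
    rw [qform, ofLp_flow, Matrix.mulVec_mulVec]
    conv_lhs => rw [exp_smul_transpose, Matrix.mulVec_transpose, ← Matrix.dotProduct_mulVec,
      Matrix.mulVec_mulVec, ← Matrix.mul_assoc, ← exp_smul_transpose]
    simp [dotProduct, Matrix.mulVec, Finset.mul_sum]
  simp_rw [accum, hq]
  rw [intervalIntegral.integral_finsetSum]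
  · rw [smul_covariance Q B ht]
    simp only [dotProduct, Matrix.mulVec, Finset.mul_sum, Matrix.of_apply]
    refine Finset.sum_congr rfl fun i _ => ?_
    rw [intervalIntegral.integral_finsetSum]
    · refine Finset.sum_congr rfl fun j _ => ?_
      rw [intervalIntegral.integral_const_mul, intervalIntegral.integral_mul_const]
    · exact fun j _ => ((hcij i j).mul_const _).const_mul _
  · refine fun i _ => Continuous.intervalIntegrable ?_ _ _
    exact continuous_finsetSum _ fun j _ => continuous_const.mul
      ((hc.matrix_elem i j).mul continuous_const)

lemma kernel_eq_gaussianDensity (Q B : Matrix (Fin N) (Fin N) ℝ) {t : ℝ} (ht : 0 < t)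
    (X Y : Space N) :
    kernel Q B X Y t = gaussianDensity (t • covariance Q B t)
      (Y - matOp (NormedSpace.exp (t • B)) X) := by
  rw [kernel, gaussianDensity, WithLp.ofLp_sub, ofLp_matOp]
  have : (t • covariance Q B t)⁻¹ = t⁻¹ • (covariance Q B t)⁻¹ := by
    -- The identity needs no invertibility: for a singular matrix both inverses are zero by
    -- convention.
    by_cases h : IsUnit (covariance Q B t).det
    · exact Matrix.inv_smul' _ (Units.mk0 t ht.ne') h
    · rw [Matrix.nonsing_inv_apply_not_isUnit _ h, Matrix.nonsing_inv_apply_not_isUnit, smul_zero]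
      rw [Matrix.det_smul]
      simp only [isUnit_iff_ne_zero, ne_eq, not_not, mul_eq_zero] at h ⊢
      exact Or.inr h
  rw [this, Matrix.smul_mulVec, smul_dotProduct, smul_eq_mul]
  congr 2
  field_simp

/-- The quadratic form of `t K(t)` controls the flow at time `t ≥ 1`. -/
lemma exists_norm_flow_sq_le_accum {Q B : Matrix (Fin N) (Fin N) ℝ} (hQ : Q.PosSemidef)
    (hK : (covariance Q B 1).PosDef) :
    ∃ κ > 0, ∀ τ, 1 ≤ τ → ∀ ξ, κ * ‖flow B τ ξ‖ ^ 2 ≤ accum Q B τ ξ := by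
  have hpos : ∀ x : Space N, x ≠ 0 → 0 < accum Q B 1 x := by
    intro x hx
    rw [← dotProduct_covariance Q B one_ne_zero, one_smul]
    have hx' : x.ofLp ≠ 0 := by simpa using hx
    simpa using hK.dotProduct_mulVec_pos hx'
  have hcont : Continuous fun x => accum Q B 1 x :=
    (continuous_accum Q B).comp (by fun_prop : Continuous fun x : Space N => ((1 : ℝ), x))
  have hhom : ∀ (r : ℝ) (x : Space N), accum Q B 1 (r • x) = r ^ 2 * accum Q B 1 x := by
    intro r x
    rw [accum, accum, ← intervalIntegral.integral_const_mul]
    congr 1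
    ext σ
    rw [map_smul, qform_eq_inner, qform_eq_inner, map_smul, real_inner_smul_left,
      real_inner_smul_right]
    ring
  obtain ⟨κ, hκ, hκ'⟩ : ∃ κ > 0, ∀ x : Space N, κ * ‖x‖ ^ 2 ≤ accum Q B 1 x := by
    -- Compactness of the unit sphere and homogeneity of degree two give `κ`; the sphere is empty
    -- only when `N = 0`.
    rcases (Metric.sphere (0 : Space N) 1).eq_empty_or_nonempty with he | hne
    · refine ⟨1, one_pos, fun x => ?_⟩
      have hx : x = 0 := by
        by_contra hx
        have : ‖x‖⁻¹ • x ∈ Metric.sphere (0 : Space N) 1 := by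
          simp [norm_smul, hx]
        simp [he] at this
      simpa [hx] using (hhom 0 0).ge
    · obtain ⟨x₀, hx₀, hmin⟩ := (isCompact_sphere (0 : Space N) 1).exists_isMinOn hne
        hcont.continuousOn
      refine ⟨accum Q B 1 x₀, hpos _ (ne_zero_of_mem_unit_sphere ⟨x₀, hx₀⟩), fun x => ?_⟩
      by_cases hx : x = 0
      · simpa [hx] using (hhom 0 0).ge
      · have hmem : ‖x‖⁻¹ • x ∈ Metric.sphere (0 : Space N) 1 := by simp [norm_smul, hx]
        have h := isMinOn_iff.1 hmin _ hmem
        rw [hhom] at h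
        have hx' : 0 < ‖x‖ := norm_pos_iff.2 hx
        calc _ ≤ (‖x‖⁻¹ ^ 2 * accum Q B 1 x) * ‖x‖ ^ 2 := by gcongr
          _ = _ := by field_simp
  -- By the group law the left side is the part of the integral over the last unit of time `[τ-1,
  -- τ]`; the rest is nonnegative.
  have hshift : ∀ τ, 1 ≤ τ → ∀ ξ, accum Q B 1 (flow B (τ - 1) ξ) ≤ accum Q B τ ξ := by
    intro τ hτ ξ
    have h : Continuous fun σ => qform Q (flow B σ ξ) :=
      (continuous_qform_flow Q B).comp (by fun_prop : Continuous fun σ : ℝ => (ξ, σ))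
    have h1 : accum Q B 1 (flow B (τ - 1) ξ) =
        ∫ σ in (τ - 1)..τ, qform Q (flow B σ ξ) := by
      have := intervalIntegral.integral_comp_add_right (a := 0) (b := 1)
        (fun σ => qform Q (flow B σ ξ)) (τ - 1)
      simp only [zero_add, add_sub_cancel] at this
      rw [← this, accum]
      simp_rw [flow_add]
      rfl
    rw [h1, accum, ← intervalIntegral.integral_add_adjacent_intervals
      (h.intervalIntegrable 0 (τ - 1)) (h.intervalIntegrable _ _)]
    have := intervalIntegral.integral_nonneg (μ := volume) (sub_nonneg.2 hτ)
      fun σ _ => qform_nonneg hQ (flow B σ ξ)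
    linarith
  -- The summand `1` avoids a separate treatment of `‖flow B 1‖ = 0`.
  have hb : 0 < ‖flow B 1‖ ^ 2 + 1 := by positivity
  refine ⟨κ / (‖flow B 1‖ ^ 2 + 1), by positivity, fun τ hτ ξ => ?_⟩
  refine le_trans ?_ ((hκ' _).trans (hshift τ hτ ξ))
  have h2 : ‖flow B τ ξ‖ ≤ ‖flow B 1‖ * ‖flow B (τ - 1) ξ‖ := by
    rw [show flow B τ = flow B 1 * flow B (τ - 1) by rw [← flow_add]; congr 1; ring]
    exact (flow B 1).le_opNorm _
  calc _ ≤ κ / (‖flow B 1‖ ^ 2 + 1) * (‖flow B 1‖ * ‖flow B (τ - 1) ξ‖) ^ 2 := by gcongr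
    _ ≤ κ / (‖flow B 1‖ ^ 2 + 1) * ((‖flow B 1‖ ^ 2 + 1) * ‖flow B (τ - 1) ξ‖ ^ 2) := by
      gcongr; nlinarith [sq_nonneg ‖flow B (τ - 1) ξ‖]
    _ = _ := by field_simp

lemma exists_norm_flow_le (B : Matrix (Fin N) (Fin N) ℝ) :
    ∃ M, 1 ≤ M ∧ ∀ τ ∈ Icc (0 : ℝ) 1, ‖flow B τ‖ ≤ M := by
  obtain ⟨M, hM⟩ := isCompact_Icc.exists_bound_of_continuousOn (continuous_flow B).continuousOn
    (s := Icc (0 : ℝ) 1)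
  exact ⟨max M 1, le_max_right _ _, fun τ hτ => (hM τ hτ).trans (le_max_left _ _)⟩

/-- The flow is bounded on `[0,1]`, so the damping exponent is `O(τ)` for small `τ`. This gives the
rate of convergence of `P_τ u` to `u`. -/
lemma exists_accum_le {Q : Matrix (Fin N) (Fin N) ℝ} (B : Matrix (Fin N) (Fin N) ℝ) :
    ∃ M, 0 ≤ M ∧ ∀ τ ∈ Icc (0 : ℝ) 1, ∀ ξ, accum Q B τ ξ ≤ M * τ * ‖ξ‖ ^ 2 := by
  obtain ⟨M, hM1, hM⟩ := exists_norm_flow_le B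
  refine ⟨‖matOp Q‖ * M ^ 2, by positivity, fun τ hτ ξ => ?_⟩
  have h := intervalIntegral.norm_integral_le_of_norm_le_const (a := 0) (b := τ)
    (f := fun σ => qform Q (flow B σ ξ))
    (C := ‖matOp Q‖ * M ^ 2 * ‖ξ‖ ^ 2) (by
      intro σ hσ
      rw [uIoc_of_le hτ.1] at hσ
      refine (abs_qform_le _ _).trans ?_
      rw [mul_assoc, ← mul_pow]
      gcongr
      exact ((flow B σ).le_opNorm ξ).trans
        (by gcongr; exact hM σ ⟨hσ.1.le, hσ.2.trans hτ.2⟩))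
  rw [sub_zero, abs_of_nonneg hτ.1] at h
  exact (le_abs_self _).trans (h.trans_eq (by ring))

/-- Hermite-type bound: powers of the flow are absorbed by the Gaussian factor. -/
lemma exists_norm_flow_pow_mul_exp_le {Q B : Matrix (Fin N) (Fin N) ℝ} (hQ : Q.PosSemidef)
    (hK : (covariance Q B 1).PosDef) (n : ℕ) :
    ∃ M, 0 ≤ M ∧ ∀ τ, 0 < τ → ∀ ξ, ‖flow B τ ξ‖ ^ n *
      Real.exp (-(4 * Real.pi ^ 2 * accum Q B τ ξ)) ≤ M * (1 + ‖ξ‖ ^ n) := by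
  obtain ⟨κ, hκ, hlow⟩ := exists_norm_flow_sq_le_accum hQ hK
  obtain ⟨M, hM1, hM⟩ := exists_norm_flow_le B
  obtain ⟨M', hM'⟩ : ∃ M', ∀ r : ℝ, 0 ≤ r → r ^ n * Real.exp (-(4 * Real.pi ^ 2 * κ * r ^ 2)) ≤ M' := by
    have hk : 0 < 4 * Real.pi ^ 2 * κ := by positivity
    refine ⟨1 + (n.factorial : ℝ) / (4 * Real.pi ^ 2 * κ) ^ n, fun r hr => ?_⟩
    rcases le_or_gt r 1 with h1 | h1
    · have h2 : r ^ n ≤ 1 := pow_le_one₀ hr h1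
      have h3 : Real.exp (-(4 * Real.pi ^ 2 * κ * r ^ 2)) ≤ 1 := by
        rw [Real.exp_le_one_iff]; have := mul_nonneg hk.le (sq_nonneg r); linarith
      have h4 : 0 ≤ (n.factorial : ℝ) / (4 * Real.pi ^ 2 * κ) ^ n := by positivity
      nlinarith [Real.exp_pos (-(4 * Real.pi ^ 2 * κ * r ^ 2)), pow_nonneg hr n]
    · have h2 := Real.pow_div_factorial_le_exp (x := 4 * Real.pi ^ 2 * κ * r ^ 2) (by positivity) n
      have h3 : r ^ n ≤ (n.factorial : ℝ) / (4 * Real.pi ^ 2 * κ) ^ n *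
          Real.exp (4 * Real.pi ^ 2 * κ * r ^ 2) := by
        have h5 : r ^ n ≤ (r ^ 2) ^ n := pow_le_pow_left₀ hr (by nlinarith) n
        rw [mul_pow, div_le_iff₀ (by positivity)] at h2
        rw [div_mul_eq_mul_div, le_div_iff₀ (by positivity)]
        calc _ ≤ (r ^ 2) ^ n * (4 * Real.pi ^ 2 * κ) ^ n := by gcongr
          _ ≤ _ := by linarith
      rw [Real.exp_neg, ← div_eq_mul_inv, div_le_iff₀ (Real.exp_pos _)]
      have h6 := Real.exp_pos (4 * Real.pi ^ 2 * κ * r ^ 2)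
      nlinarith
  have hM'0 : 0 ≤ M' := le_trans (by positivity) (hM' 0 le_rfl)
  refine ⟨max (M ^ n) M', le_max_of_le_right hM'0, fun τ hτ ξ => ?_⟩
  have ha := accum_nonneg hQ B hτ.le ξ
  -- For `τ ≤ 1` the flow itself is bounded and no damping is needed; for `τ > 1` the coercivity of
  -- the quadratic form gives a bound independent of `ξ`.
  rcases le_or_gt τ 1 with h1 | h1
  · have h2 : Real.exp (-(4 * Real.pi ^ 2 * accum Q B τ ξ)) ≤ 1 := by
      rw [Real.exp_le_one_iff]; have : 0 ≤ 4 * Real.pi ^ 2 * accum Q B τ ξ := by positivity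
      linarith
    calc _ ≤ (M * ‖ξ‖) ^ n * 1 := by
          gcongr
          exact ((flow B τ).le_opNorm ξ).trans (by gcongr; exact hM τ ⟨hτ.le, h1⟩)
      _ = M ^ n * ‖ξ‖ ^ n := by rw [mul_pow, mul_one]
      _ ≤ max (M ^ n) M' * (1 + ‖ξ‖ ^ n) := by
          gcongr
          · exact le_max_left _ _
          · linarith
  · calc _ ≤ ‖flow B τ ξ‖ ^ n * Real.exp (-(4 * Real.pi ^ 2 * κ * ‖flow B τ ξ‖ ^ 2)) := by
          gcongr _ * Real.exp (-?_)
          have := hlow τ h1.le ξ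
          rw [mul_assoc _ κ]
          gcongr
      _ ≤ M' := hM' _ (norm_nonneg _)
      _ ≤ max (M ^ n) M' * 1 := by rw [mul_one]; exact le_max_right _ _
      _ ≤ _ := by
          gcongr
          · have : 0 ≤ ‖ξ‖ ^ n := by positivity
            linarith

end Flow

/-! ### Treating real and complex values together -/

section Embedding

variable {𝕜 : Type*} [RCLike 𝕜]

/-- The real-linear embedding of `𝕜` into `ℂ`. -/
def toC : 𝕜 →L[ℝ] ℂ :=
  Complex.ofRealCLM.comp RCLike.reCLM + (RCLike.imCLM : 𝕜 →L[ℝ] ℝ).smulRight Complex.I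

/-- A real-linear left inverse of `toC`. -/
def ofC : ℂ →L[ℝ] 𝕜 :=
  RCLike.ofRealCLM.comp Complex.reCLM + Complex.imCLM.smulRight (RCLike.I : 𝕜)

lemma ofC_toC (x : 𝕜) : ofC (toC x) = x := by
  conv_rhs => rw [← RCLike.re_add_im x]
  simp [ofC, toC, RCLike.real_smul_eq_coe_mul]

end Embedding

/-! ### Fourier inversion for Schwartz data -/

section Fourier

variable {N : ℕ} {𝕜 : Type*} [RCLike 𝕜]

/-- The space of frequencies `(ξ, θ)` dual to `(X, t)`. -/
abbrev Freq (N : ℕ) : Type := Space N × ℝ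

/-- The plane wave `e^{2πi(⟨ξ,Y⟩+θr)}`. -/
def wave (v : Freq N) (Y : Space N) (r : ℝ) : ℂ :=
  Complex.exp (2 * Real.pi * Complex.I * (inner ℝ v.1 Y + v.2 * r : ℝ))

lemma norm_cexp_two_pi_I (x : ℝ) : ‖Complex.exp (2 * Real.pi * Complex.I * (x : ℝ))‖ = 1 := by
  rw [Complex.norm_exp]
  simp

lemma norm_wave (v : Freq N) (Y : Space N) (r : ℝ) : ‖wave v Y r‖ = 1 :=
  norm_cexp_two_pi_I _

/-- Continuity and integrability of all moments of a function on the frequency space. -/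
structure HasMoments (f : Freq N → ℂ) : Prop where
  continuous : Continuous f
  integrable_pow (n : ℕ) : Integrable fun v : Freq N => ‖v‖ ^ n * ‖f v‖

lemma HasMoments.integrable_norm {f : Freq N → ℂ} (hf : HasMoments f) :
    Integrable fun v : Freq N => ‖f v‖ := by
  simpa using hf.integrable_pow 0

/-- Fourier inversion for the complexified function. The product `Space N × ℝ` carries the sup norm,
so the transform is taken on its `L²` version and pulled back by a measure-preserving linear
equivalence. -/
lemma exists_fourier_repr (u : 𝓢(Space N × ℝ, 𝕜)) : ∃ f : Freq N → ℂ, HasMoments f ∧ ∀ Y r,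
    u (Y, r) = ofC (∫ v : Freq N, wave v Y r * f v) := by
  let e := WithLp.prodContinuousLinearEquiv 2 ℝ (Space N) ℝ
  let g : 𝓢(WithLp 2 (Space N × ℝ), ℂ) :=
    SchwartzMap.compCLMOfContinuousLinearEquiv ℝ e (u.postcompCLM toC)
  let f : 𝓢(Freq N, ℂ) :=
    SchwartzMap.compCLMOfContinuousLinearEquiv ℝ e.symm (FourierTransform.fourier g)
  have hf (v : Freq N) : f v = (FourierTransform.fourier g) (WithLp.toLp 2 v) := rfl
  have hvol : (volume : Measure (Space N × ℝ)).IsAddHaarMeasure :=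
    Measure.prod.instIsAddHaarMeasure volume volume
  refine ⟨f, ⟨f.continuous, fun n => f.integrable_pow_mul volume n⟩, fun Y r => ?_⟩
  have h1 : g (WithLp.toLp 2 (Y, r)) = toC (u (Y, r)) := rfl
  have h2 : FourierTransformInv.fourierInv (FourierTransform.fourier g) = g :=
    FourierTransform.fourierInv_fourier_eq g
  have h3 : g (WithLp.toLp 2 (Y, r)) = ∫ v : Freq N, wave v Y r * f v := by
    conv_lhs => rw [← h2, SchwartzMap.fourierInv_coe, Real.fourierInv_eq']
    rw [← (WithLp.volume_preserving_toLp (U := Space N) (V := ℝ)).integral_comp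
      e.symm.toHomeomorph.measurableEmbedding]
    congr 1
    ext v
    rw [smul_eq_mul, wave, WithLp.prod_inner_apply, hf]
    congr 2
    simp
    ring
  rw [← h3, h1, ofC_toC]

lemma continuous_wave : Continuous fun p : Freq N × Space N × ℝ => wave p.1 p.2.1 p.2.2 := by
  unfold wave
  have h1 : Continuous fun v : Freq N => v.1 := by fun_prop
  have h2 : Continuous fun v : Freq N => v.2 := by fun_prop
  fun_prop

end Fourier

/-! ### The evolutive semigroup as a Fourier multiplier -/

section Semigroup

variable {N : ℕ} {𝕜 : Type*} [RCLike 𝕜] {Q B : Matrix (Fin N) (Fin N) ℝ}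

lemma posDef_smul_covariance {t : ℝ} (ht : 0 < t) (hK : (covariance Q B t).PosDef) :
    (t • covariance Q B t).PosDef :=
  hK.smul ht

lemma kernel_nonneg {t : ℝ} (ht : 0 < t) (hK : (covariance Q B t).PosDef) (X Y : Space N) :
    0 ≤ kernel Q B X Y t := by
  rw [kernel_eq_gaussianDensity Q B ht]
  exact gaussianDensity_nonneg (posDef_smul_covariance ht hK) _

lemma integrable_kernel {t : ℝ} (ht : 0 < t) (hK : (covariance Q B t).PosDef) (X : Space N) :
    Integrable fun Y => kernel Q B X Y t := by
  simp_rw [kernel_eq_gaussianDensity Q B ht]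
  exact (integrable_gaussianDensity (posDef_smul_covariance ht hK)).comp_sub_right _

lemma integral_kernel {t : ℝ} (ht : 0 < t) (hK : (covariance Q B t).PosDef) (X : Space N) :
    ∫ Y, kernel Q B X Y t = 1 := by
  simp_rw [kernel_eq_gaussianDensity Q B ht]
  rw [integral_sub_right_eq_self (fun y => gaussianDensity (t • covariance Q B t) y),
    integral_gaussianDensity (posDef_smul_covariance ht hK)]

/-- Translating by the mean `e^{tB}X` leaves the characteristic function of the centred Gaussian and
a phase, which the adjoint flow rewrites. -/
lemma integral_kernel_mul_exp {t : ℝ} (ht : 0 < t) (hK : (covariance Q B t).PosDef)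
    (X ξ : Space N) :
    ∫ Y, (kernel Q B X Y t : ℂ) * Complex.exp (2 * Real.pi * Complex.I * (inner ℝ ξ Y : ℝ)) =
      Complex.exp (2 * Real.pi * Complex.I * (inner ℝ (flow B t ξ) X : ℝ) -
        (4 * Real.pi ^ 2 * accum Q B t ξ : ℝ)) := by
  set m := matOp (NormedSpace.exp (t • B)) X with hm
  have h1 : ∀ Y, (kernel Q B X Y t : ℂ) *
      Complex.exp (2 * Real.pi * Complex.I * (inner ℝ ξ Y : ℝ)) =
      Complex.exp (2 * Real.pi * Complex.I * (inner ℝ ξ m : ℝ)) *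
      ((gaussianDensity (t • covariance Q B t) (Y - m) : ℂ) *
      Complex.exp (2 * Real.pi * Complex.I * (inner ℝ ξ (Y - m) : ℝ))) := by
    intro Y
    rw [kernel_eq_gaussianDensity Q B ht, mul_left_comm, ← Complex.exp_add]
    congr 2
    rw [inner_sub_right]
    push_cast
    ring
  simp_rw [h1]
  rw [integral_const_mul, integral_sub_right_eq_self (fun Y =>
    (gaussianDensity (t • covariance Q B t) Y : ℂ) *
      Complex.exp (2 * Real.pi * Complex.I * (inner ℝ ξ Y : ℝ))),
    integral_gaussianDensity_mul (posDef_smul_covariance ht hK),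
    dotProduct_covariance Q B ht.ne', ← Complex.exp_add, hm, inner_exp_smul]
  rfl

lemma continuous_kernel (t : ℝ) (X : Space N) :
    Continuous fun Y => kernel Q B X Y t := by
  unfold kernel
  have h : Continuous fun Y : Space N => Y.ofLp := by fun_prop
  fun_prop

/-- The Fourier multiplier of the evolutive semigroup. -/
def symbol (Q B : Matrix (Fin N) (Fin N) ℝ) (τ : ℝ) (v : Freq N) (X : Space N) (t : ℝ) : ℂ :=
  Complex.exp (2 * Real.pi * Complex.I * (inner ℝ (flow B τ v.1) X + v.2 * (t - τ) : ℝ) -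
    (4 * Real.pi ^ 2 * accum Q B τ v.1 : ℝ))

lemma norm_symbol (τ : ℝ) (v : Freq N) (X : Space N) (t : ℝ) :
    ‖symbol Q B τ v X t‖ = Real.exp (-(4 * Real.pi ^ 2 * accum Q B τ v.1)) := by
  rw [symbol, sub_eq_add_neg, Complex.exp_add, norm_mul, norm_cexp_two_pi_I, one_mul,
    ← Complex.ofReal_neg, Complex.norm_exp_ofReal]

lemma norm_symbol_le_one (hQ : Q.PosSemidef) {τ : ℝ} (hτ : 0 ≤ τ) (v : Freq N) (X : Space N)
    (t : ℝ) : ‖symbol Q B τ v X t‖ ≤ 1 := by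
  rw [norm_symbol, Real.exp_le_one_iff]
  have := accum_nonneg hQ B hτ v.1
  have : 0 ≤ 4 * Real.pi ^ 2 * accum Q B τ v.1 := by positivity
  linarith

lemma continuous_symbol {α : Type*} [TopologicalSpace α] {τ t : α → ℝ} {v : α → Freq N}
    {X : α → Space N} (hτ : Continuous τ) (hv : Continuous v) (hX : Continuous X)
    (ht : Continuous t) : Continuous fun a => symbol Q B (τ a) (v a) (X a) (t a) := by
  unfold symbol
  have h0 := continuous_flow B
  have h3 : Continuous fun a => accum Q B (τ a) (v a).1 :=
    (continuous_accum Q B).comp (hτ.prodMk hv.fst)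
  have h4 : Continuous fun a => flow B (τ a) (v a).1 := (h0.comp hτ).clm_apply hv.fst
  fun_prop

lemma integrable_symbol_mul (hQ : Q.PosSemidef) {f : Freq N → ℂ} (hf : HasMoments f) {τ : ℝ} (hτ : 0 ≤ τ)
    (X : Space N) (t : ℝ) : Integrable fun v : Freq N => symbol Q B τ v X t * f v := by
  refine hf.integrable_norm.mono' ?_ (ae_of_all _ fun v => ?_)
  · have h : Continuous fun v : Freq N => symbol Q B τ v X t :=
      continuous_symbol continuous_const continuous_id continuous_const continuous_const
    exact (h.mul hf.continuous).aestronglyMeasurable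
  · rw [norm_mul]
    exact mul_le_of_le_one_left (norm_nonneg _) (norm_symbol_le_one hQ hτ v X t)

lemma integrable_wave_mul {f : Freq N → ℂ} (hf : HasMoments f) (Y : Space N) (r : ℝ) :
    Integrable fun v : Freq N => wave v Y r * f v := by
  refine hf.integrable_norm.mono' ?_ (ae_of_all _ fun v => ?_)
  · have h : Continuous fun v : Freq N => wave v Y r :=
      continuous_wave.comp (by fun_prop : Continuous fun v : Freq N => (v, Y, r))
    exact (h.mul hf.continuous).aestronglyMeasurable
  · rw [norm_mul, norm_wave, one_mul]

lemma integral_kernel_mul_wave {τ : ℝ} (hτ : 0 < τ) (hK : (covariance Q B τ).PosDef)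
    (X : Space N) (t : ℝ) (v : Freq N) :
    ∫ Y, (kernel Q B X Y τ : ℂ) * wave v Y (t - τ) = symbol Q B τ v X t := by
  have h : ∀ Y, (kernel Q B X Y τ : ℂ) * wave v Y (t - τ) =
      Complex.exp (2 * Real.pi * Complex.I * (v.2 * (t - τ) : ℝ)) * ((kernel Q B X Y τ : ℂ) *
        Complex.exp (2 * Real.pi * Complex.I * (inner ℝ v.1 Y : ℝ))) := by
    intro Y
    rw [wave, mul_left_comm, ← Complex.exp_add]
    congr 2
    push_cast
    ring
  simp_rw [h]
  rw [integral_const_mul, integral_kernel_mul_exp hτ hK, symbol, ← Complex.exp_add]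
  congr 1
  push_cast
  ring

/-- Fourier representation of the evolutive semigroup. -/
lemma evolutiveSemigroup_eq {u : 𝓢(Space N × ℝ, 𝕜)} {f : Freq N → ℂ} (hfm : HasMoments f)
    (hf : ∀ Y r, u (Y, r) = ofC (∫ v : Freq N, wave v Y r * f v))
    {τ : ℝ} (hτ : 0 < τ) (hK : (covariance Q B τ).PosDef) (X : Space N) (t : ℝ) :
    evolutiveSemigroup Q B τ u X t = ofC (∫ v : Freq N, symbol Q B τ v X t * f v) := by
  -- Plane waves have modulus one, so the integrand is dominated by a product of integrable
  -- functions and Fubini applies.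
  have hint : Integrable (Function.uncurry fun (Y : Space N) (v : Freq N) =>
      (kernel Q B X Y τ : ℂ) * wave v Y (t - τ) * f v) (volume.prod volume) := by
    refine ((integrable_kernel hτ hK X).norm.mul_prod hfm.integrable_norm).mono' ?_
      (ae_of_all _ fun p => ?_)
    · refine Continuous.aestronglyMeasurable ?_
      have h1 := (continuous_kernel (Q := Q) (B := B) τ X)
      have h2 : Continuous fun p : Space N × Freq N => wave p.2 p.1 (t - τ) :=
        continuous_wave.comp (by fun_prop : Continuous fun p : Space N × Freq N => (p.2, p.1, t - τ))
      have h3 := hfm.continuous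
      exact ((Complex.continuous_ofReal.comp (h1.comp continuous_fst)).mul h2).mul
        (h3.comp continuous_snd)
    · simp [Function.uncurry, norm_wave]
  have h1 : ∀ Y, kernel Q B X Y τ • u (Y, t - τ) =
      ofC (∫ v : Freq N, (kernel Q B X Y τ : ℂ) * wave v Y (t - τ) * f v) := by
    intro Y
    rw [hf, ← map_smul, ← integral_smul]
    congr 2
    ext v
    rw [Complex.real_smul, mul_assoc]
  rw [evolutiveSemigroup]
  rw [integral_congr_ae (ae_of_all _ h1)]
  refine (ContinuousLinearMap.integral_comp_comm (ofC (𝕜 := 𝕜)) hint.integral_prod_left).trans ?_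
  refine congrArg _ ((integral_integral_swap hint).trans ?_)
  congr 1
  ext v
  rw [integral_mul_const, integral_kernel_mul_wave hτ hK]

end Semigroup

/-! ### Smoothness of superpositions of exponentials -/

section ExpIntegral

variable {α D H : Type*} [MeasurableSpace α] [NormedAddCommGroup D] [NormedSpace ℝ D]
  [NormedAddCommGroup H] [NormedSpace ℝ H] {m : Measure α} {L : D →L[ℝ] H →L[ℝ] ℂ} {p : α → D}
  {Ω : Set H} {k : α → ℂ}

/-- The superposition `∫ e^{L(p(a))x} k(a) dm(a)` of exponentials. -/
def expIntegral (m : Measure α) (L : D →L[ℝ] H →L[ℝ] ℂ) (p : α → D) (k : α → ℂ) (x : H) : ℂ :=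
  ∫ a, Complex.exp (L (p a) x) * k a ∂m

/-- Locally uniform integrability on `Ω` of all moments of the integrand of `expIntegral`. -/
structure ExpIntegrable (m : Measure α) (L : D →L[ℝ] H →L[ℝ] ℂ) (p : α → D) (Ω : Set H)
    (k : α → ℂ) : Prop where
  aestronglyMeasurable_exponent : AEStronglyMeasurable p m
  aestronglyMeasurable : AEStronglyMeasurable k m
  exists_bound : ∀ x ∈ Ω, ∀ n : ℕ, ∃ s ∈ 𝓝 x, ∃ b : α → ℝ, Integrable b m ∧
    ∀ᵐ a ∂m, ∀ y ∈ s, ‖p a‖ ^ n * ‖Complex.exp (L (p a) y) * k a‖ ≤ b a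

namespace ExpIntegrable

lemma norm_smul_le (z : ℂ) (d : D) : ‖z • L d‖ ≤ ‖L‖ * (‖d‖ ^ 1 * ‖z‖) := by
  rw [norm_smul]
  calc _ ≤ ‖z‖ * (‖L‖ * ‖d‖) := by gcongr; exact L.le_opNorm _
    _ = _ := by ring

/-- Each derivative costs one power of `‖p a‖`. Requiring bounds for all moments makes the class
stable under differentiation. -/
lemma mul (hk : ExpIntegrable m L p Ω k) (h : H) :
    ExpIntegrable m L p Ω (fun a => L (p a) h * k a) where
  aestronglyMeasurable_exponent := hk.aestronglyMeasurable_exponent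
  aestronglyMeasurable :=
    ((by fun_prop : Continuous fun d => L d h).comp_aestronglyMeasurable
      hk.aestronglyMeasurable_exponent).mul hk.aestronglyMeasurable
  exists_bound x hx n := by
    obtain ⟨s, hs, b, hb, hbs⟩ := hk.exists_bound x hx (n + 1)
    refine ⟨s, hs, fun a => ‖L‖ * ‖h‖ * b a, hb.const_mul _, ?_⟩
    filter_upwards [hbs] with a ha y hy
    have h1 : ‖L (p a) h‖ ≤ ‖L‖ * ‖p a‖ * ‖h‖ := L.le_opNorm₂ _ _
    calc _ = ‖p a‖ ^ n * ‖Complex.exp (L (p a) y) * k a‖ * ‖L (p a) h‖ := by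
          simp only [norm_mul]; ring
      _ ≤ ‖p a‖ ^ n * ‖Complex.exp (L (p a) y) * k a‖ * (‖L‖ * ‖p a‖ * ‖h‖) := by gcongr
      _ = ‖L‖ * ‖h‖ * (‖p a‖ ^ (n + 1) * ‖Complex.exp (L (p a) y) * k a‖) := by ring
      _ ≤ _ := by gcongr; exact ha y hy

lemma aestronglyMeasurable_integrand (hk : ExpIntegrable m L p Ω k) (x : H) :
    AEStronglyMeasurable (fun a => Complex.exp (L (p a) x) * k a) m :=
  ((by fun_prop : Continuous fun d => Complex.exp (L d x)).comp_aestronglyMeasurable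
    hk.aestronglyMeasurable_exponent).mul hk.aestronglyMeasurable

lemma integrable (hk : ExpIntegrable m L p Ω k) {x : H} (hx : x ∈ Ω) :
    Integrable (fun a => Complex.exp (L (p a) x) * k a) m := by
  obtain ⟨s, hs, b, hb, hbs⟩ := hk.exists_bound x hx 0
  refine hb.mono' (hk.aestronglyMeasurable_integrand x) ?_
  filter_upwards [hbs] with a ha
  simpa using ha x (mem_of_mem_nhds hs)

lemma aestronglyMeasurable_deriv (hk : ExpIntegrable m L p Ω k) (x : H) :
    AEStronglyMeasurable (fun a => (Complex.exp (L (p a) x) * k a) • L (p a)) m :=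
  (hk.aestronglyMeasurable_integrand x).smul
    (L.continuous.comp_aestronglyMeasurable hk.aestronglyMeasurable_exponent)

lemma integrable_deriv (hk : ExpIntegrable m L p Ω k) {x : H} (hx : x ∈ Ω) :
    Integrable (fun a => (Complex.exp (L (p a) x) * k a) • L (p a)) m := by
  obtain ⟨s, hs, b, hb, hbs⟩ := hk.exists_bound x hx 1
  refine (hb.const_mul ‖L‖).mono' (hk.aestronglyMeasurable_deriv x) ?_
  filter_upwards [hbs] with a ha
  exact (norm_smul_le _ _).trans (by gcongr; exact ha x (mem_of_mem_nhds hs))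

lemma hasFDerivAt (hk : ExpIntegrable m L p Ω k) {x : H} (hx : x ∈ Ω) :
    HasFDerivAt (expIntegral m L p k)
      (∫ a, (Complex.exp (L (p a) x) * k a) • L (p a) ∂m) x := by
  obtain ⟨s, hs, b, hb, hbs⟩ := hk.exists_bound x hx 1
  refine hasFDerivAt_integral_of_dominated_of_fderiv_le (𝕜 := ℝ)
    (F' := fun y a => (Complex.exp (L (p a) y) * k a) • L (p a)) (bound := fun a => ‖L‖ * b a) hs
    (Eventually.of_forall fun y => hk.aestronglyMeasurable_integrand y) (hk.integrable hx)
    (hk.aestronglyMeasurable_deriv x) ?_ (hb.const_mul _) (ae_of_all _ fun a y _ => ?_)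
  · filter_upwards [hbs] with a ha y hy
    exact (norm_smul_le _ _).trans (by gcongr; exact ha y hy)
  · have h1 : HasFDerivAt (fun y => Complex.exp (L (p a) y)) _ y :=
      (L (p a)).hasFDerivAt.cexp
    refine (h1.mul_const (k a)).congr_fderiv ?_
    ext h
    simp
    ring

lemma integral_deriv_apply (hk : ExpIntegrable m L p Ω k) {x : H} (hx : x ∈ Ω) (h : H) :
    (∫ a, (Complex.exp (L (p a) x) * k a) • L (p a) ∂m) h =
      expIntegral m L p (fun a => L (p a) h * k a) x := by
  rw [ContinuousLinearMap.integral_apply (hk.integrable_deriv hx), expIntegral]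
  congr 1
  ext a
  simp
  ring

lemma fderiv_apply (hk : ExpIntegrable m L p Ω k) {x : H} (hx : x ∈ Ω) (h : H) :
    fderiv ℝ (expIntegral m L p k) x h = expIntegral m L p (fun a => L (p a) h * k a) x := by
  rw [(hk.hasFDerivAt hx).fderiv, hk.integral_deriv_apply hx]

/-- Directional derivatives of `expIntegral`. -/
lemma hasDerivAt_line (hk : ExpIntegrable m L p Ω k) {x : H} (hx : x ∈ Ω) {γ : ℝ → H} {h : H}
    {r : ℝ} (hγ : HasDerivAt γ h r) (hr : γ r = x) :
    HasDerivAt (fun r => expIntegral m L p k (γ r))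
      (expIntegral m L p (fun a => L (p a) h * k a) x) r := by
  have h1 := hk.hasFDerivAt hx
  rw [← hr] at h1
  have := h1.comp_hasDerivAt r hγ
  rwa [hr, hk.integral_deriv_apply hx] at this

/-- Every directional derivative is again a superposition of the same exponentials with an amplitude
in the same class, so induction on the order applies to all amplitudes at once. -/
lemma contDiffOn [FiniteDimensional ℝ H] (hΩ : IsOpen Ω) (hk : ExpIntegrable m L p Ω k) :
    ContDiffOn ℝ ∞ (expIntegral m L p k) Ω := by
  refine contDiffOn_infty.2 fun n => ?_
  induction n generalizing k with
  | zero =>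
    exact contDiffOn_zero.2 fun x hx => (hk.hasFDerivAt hx).continuousAt.continuousWithinAt
  | succ n ih =>
    push_cast
    refine (contDiffOn_succ_iff_fderiv_of_isOpen hΩ).2
      ⟨fun x hx => (hk.hasFDerivAt hx).differentiableAt.differentiableWithinAt, by simp, ?_⟩
    exact contDiffOn_clm_apply.2 fun h => (ih (hk.mul h)).congr fun x hx => hk.fderiv_apply hx h

end ExpIntegrable

end ExpIntegral

/-! ### The weight `τ^{-1-s}e^{-w/τ}` -/

section Weight

/-- The weight `τ^{-1-s} e^{-w/τ}`. -/
def weight (s w τ : ℝ) : ℝ := τ ^ (-1 - s) * Real.exp (-(w / τ))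

lemma weight_nonneg (s w : ℝ) {τ : ℝ} (hτ : 0 < τ) : 0 ≤ weight s w τ := by
  unfold weight; positivity

/-- The substitution `τ ↦ 1/τ` turns the weight into the integrand of the Gamma function; the first
factor is its Jacobian. -/
lemma weight_eq_comp_rpow (s w : ℝ) {τ : ℝ} (hτ : 0 < τ) :
    (|(-1 : ℝ)| * τ ^ ((-1 : ℝ) - 1)) • ((τ ^ (-1 : ℝ)) ^ (s - 1) * Real.exp (-(w * τ ^ (-1 : ℝ)))) =
      weight s w τ := by
  rw [weight, ← Real.rpow_mul hτ.le, abs_neg, abs_one, one_mul, smul_eq_mul, ← mul_assoc,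
    ← Real.rpow_add hτ, Real.rpow_neg_one, div_eq_mul_inv]
  ring_nf

lemma integrableOn_weight {s w : ℝ} (hs : 0 < s) (hw : 0 < w) :
    IntegrableOn (weight s w) (Ioi 0) := by
  have h := integrableOn_rpow_mul_exp_neg_mul_rpow (p := 1) (s := s - 1) (b := w) (by linarith)
    one_pos hw
  simp only [Real.rpow_one, neg_mul] at h
  refine ((integrableOn_Ioi_comp_rpow_iff _ (by norm_num : (-1 : ℝ) ≠ 0)).2 h).congr_fun
    (fun τ hτ => weight_eq_comp_rpow s w hτ) measurableSet_Ioi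

lemma integral_weight {s w : ℝ} (hs : 0 < s) (hw : 0 < w) :
    ∫ τ in Ioi (0 : ℝ), weight s w τ = (1 / w) ^ s * Real.Gamma s := by
  rw [← Real.integral_rpow_mul_exp_neg_mul_Ioi hs hw,
    ← integral_comp_rpow_Ioi (fun r : ℝ => r ^ (s - 1) * Real.exp (-(w * r)))
      (by norm_num : (-1 : ℝ) ≠ 0)]
  exact setIntegral_congr_fun measurableSet_Ioi fun τ hτ => (weight_eq_comp_rpow s w hτ).symm

/-- The factor in brackets is also what `w∂_ww + (s+1)∂_w` produces on the weight: the weight solves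
a heat-type equation. -/
lemma hasDerivAt_weight (s w : ℝ) {τ : ℝ} (hτ : 0 < τ) :
    HasDerivAt (weight s w) ((-(s + 1) * τ⁻¹ + w * τ⁻¹ ^ 2) * weight s w τ) τ := by
  have h1 : HasDerivAt (fun τ : ℝ => τ ^ (-1 - s)) ((-1 - s) * τ ^ (-1 - s - 1)) τ :=
    Real.hasDerivAt_rpow_const (Or.inl hτ.ne')
  have h2 : HasDerivAt (fun τ : ℝ => -(w / τ)) (w * τ⁻¹ ^ 2) τ := by
    have := ((hasDerivAt_inv hτ.ne').const_mul w).neg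
    simp only [div_eq_mul_inv]
    convert! this using 1
    field_simp
  refine (h1.mul h2.exp).congr_deriv ?_
  rw [weight, Real.rpow_sub_one hτ.ne']
  field_simp
  ring

lemma tendsto_weight_zero (s : ℝ) {w : ℝ} (hw : 0 < w) :
    Tendsto (weight s w) (𝓝[>] 0) (𝓝 0) := by
  have h := (tendsto_rpow_mul_exp_neg_mul_atTop_nhds_zero (1 + s) w hw).comp
    tendsto_inv_nhdsGT_zero
  refine h.congr' ?_
  filter_upwards [self_mem_nhdsWithin] with τ hτ
  have hτ : 0 < τ := hτ
  simp only [Function.comp, weight]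
  rw [Real.inv_rpow hτ.le, ← Real.rpow_neg hτ.le, neg_mul, div_eq_mul_inv]
  ring_nf

lemma tendsto_weight_atTop {s w : ℝ} (hs : 0 < s) (hw : 0 < w) :
    Tendsto (weight s w) atTop (𝓝 0) := by
  have h := tendsto_rpow_neg_atTop (y := 1 + s) (by linarith)
  refine squeeze_zero' ?_ ?_ h
  · filter_upwards [eventually_gt_atTop 0] with τ hτ using weight_nonneg s w hτ
  · filter_upwards [eventually_gt_atTop 0] with τ hτ
    rw [weight, show -(1 + s) = -1 - s by ring]
    refine mul_le_of_le_one_right (by positivity) ?_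
    rw [Real.exp_le_one_iff]
    have : 0 < w / τ := by positivity
    linarith

end Weight

/-! ### The extension as a superposition of elementary solutions -/

section Superposition

variable {N : ℕ}

/-- Exponents of the elementary solutions: `(η, θ, λ)` paired with `(X, t, w)` gives
`2πi(⟨η,X⟩ + θt) - λw`. -/
def exponent (N : ℕ) : (Space N × ℝ × ℝ) →L[ℝ] (Space N × ℝ × ℝ) →L[ℝ] ℂ :=
  ((ContinuousLinearMap.compL ℝ (Space N × ℝ × ℝ) ℝ ℂ)
      ((1 : ℝ →L[ℝ] ℝ).smulRight (2 * Real.pi * Complex.I))).comp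
    ((isBoundedBilinearMap_inner (𝕜 := ℝ) (E := Space N)).toContinuousLinearMap.bilinearComp (ContinuousLinearMap.fst ℝ (Space N) (ℝ × ℝ))
        (ContinuousLinearMap.fst ℝ (Space N) (ℝ × ℝ)) +
      (ContinuousLinearMap.mul ℝ ℝ).bilinearComp
        ((ContinuousLinearMap.fst ℝ ℝ ℝ).comp (ContinuousLinearMap.snd ℝ (Space N) (ℝ × ℝ)))
        ((ContinuousLinearMap.fst ℝ ℝ ℝ).comp (ContinuousLinearMap.snd ℝ (Space N) (ℝ × ℝ)))) -
  ((ContinuousLinearMap.compL ℝ (Space N × ℝ × ℝ) ℝ ℂ) Complex.ofRealCLM).comp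
      ((ContinuousLinearMap.mul ℝ ℝ).bilinearComp
        ((ContinuousLinearMap.snd ℝ ℝ ℝ).comp (ContinuousLinearMap.snd ℝ (Space N) (ℝ × ℝ)))
        ((ContinuousLinearMap.snd ℝ ℝ ℝ).comp (ContinuousLinearMap.snd ℝ (Space N) (ℝ × ℝ))))

lemma exponent_apply (d x : Space N × ℝ × ℝ) :
    exponent N d x = 2 * Real.pi * Complex.I * (inner ℝ d.1 x.1 + d.2.1 * x.2.1 : ℝ) -
      (d.2.2 * x.2.2 : ℝ) := by
  simp only [exponent, sub_apply, ContinuousLinearMap.comp_apply,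
    ContinuousLinearMap.compL_apply, ContinuousLinearMap.smulRight_apply,
    add_apply, ContinuousLinearMap.bilinearComp_apply,
    ContinuousLinearMap.mul_apply', one_apply_eq_self, IsBoundedBilinearMap.toContinuousLinearMap_apply,
    ContinuousLinearMap.coe_fst', ContinuousLinearMap.coe_snd', Complex.real_smul,
    Complex.ofRealCLM_apply]
  ring

/-- The product of Lebesgue measure on `τ > 0` and on the frequencies. -/
def freqMeasure (N : ℕ) : Measure (ℝ × Freq N) := (volume.restrict (Ioi (0 : ℝ))).prod volume

/-- The exponent `(e^{τB*}ξ, θ, 1/τ)` of the elementary solution with frequency `(ξ, θ)`. -/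
def freqExponent (B : Matrix (Fin N) (Fin N) ℝ) (a : ℝ × Freq N) : Space N × ℝ × ℝ :=
  (flow B a.1 a.2.1, a.2.2, a.1⁻¹)

/-- The amplitude of the elementary solution with frequency `(ξ, θ)`. -/
def freqAmplitude (Q B : Matrix (Fin N) (Fin N) ℝ) (s : ℝ) (f : Freq N → ℂ) (a : ℝ × Freq N) : ℂ :=
  ((a.1 ^ (-1 - s) : ℝ) : ℂ) * symbol Q B a.1 a.2 0 0 * f a.2

variable {Q B : Matrix (Fin N) (Fin N) ℝ}

/-- All dependence on `(X,t,w)` sits in an exponential that is linear in these variables; the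
amplitude keeps the rest, evaluated at the origin. -/
lemma exp_exponent_mul_freqAmplitude (s : ℝ) (f : Freq N → ℂ) (a : ℝ × Freq N)
    (x : Space N × ℝ × ℝ) :
    Complex.exp (exponent N (freqExponent B a) x) * freqAmplitude Q B s f a =
      (weight s x.2.2 a.1 : ℂ) * (symbol Q B a.1 a.2 x.1 x.2.1 * f a.2) := by
  have h : Complex.exp (exponent N (freqExponent B a) x) * symbol Q B a.1 a.2 0 0 =
      (Real.exp (-(x.2.2 / a.1)) : ℂ) * symbol Q B a.1 a.2 x.1 x.2.1 := by
    rw [exponent_apply, symbol, symbol, ← Complex.exp_add, Complex.ofReal_exp, ← Complex.exp_add,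
      freqExponent, inner_zero_right]
    congr 1
    push_cast
    ring
  rw [freqAmplitude, weight, Complex.ofReal_mul]
  linear_combination (((a.1 ^ (-1 - s) : ℝ) : ℂ) * f a.2) * h

lemma ae_freqMeasure_pos : ∀ᵐ a ∂freqMeasure N, 0 < a.1 := by
  have h : ∀ᵐ τ ∂(volume.restrict (Ioi (0 : ℝ))), 0 < τ := ae_restrict_mem measurableSet_Ioi
  exact Measure.quasiMeasurePreserving_fst.ae h

lemma aestronglyMeasurable_freqExponent :
    AEStronglyMeasurable (freqExponent B) (freqMeasure N) := by
  have h1 : Continuous fun a : ℝ × Freq N => flow B a.1 a.2.1 :=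
    ((continuous_flow B).comp continuous_fst).clm_apply (by fun_prop)
  have h2 : Measurable fun a : ℝ × Freq N => (a.2.2, a.1⁻¹) := by fun_prop
  exact (h1.measurable.prodMk h2).aestronglyMeasurable

lemma aestronglyMeasurable_freqAmplitude (s : ℝ) {f : Freq N → ℂ} (hf : HasMoments f) :
    AEStronglyMeasurable (freqAmplitude Q B s f) (freqMeasure N) := by
  have h1 : Continuous fun a : ℝ × Freq N => symbol Q B a.1 a.2 0 0 :=
    continuous_symbol continuous_fst continuous_snd continuous_const continuous_const
  have h2 : Measurable fun a : ℝ × Freq N => ((a.1 ^ (-1 - s) : ℝ) : ℂ) := by fun_prop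
  exact ((h2.mul h1.measurable).mul
    (hf.continuous.measurable.comp measurable_snd)).aestronglyMeasurable

/-- There are three sources of growth. Powers of `e^{τB*}ξ` are absorbed by the damping factor,
powers of `θ` by the moments of `f`, and powers of `1/τ` by `e^{-w/τ}`. -/
lemma expIntegrable_freq (hQ : Q.PosSemidef) (hK : (covariance Q B 1).PosDef) {s : ℝ} (hs : 0 < s)
    {f : Freq N → ℂ} (hf : HasMoments f) :
    ExpIntegrable (freqMeasure N) (exponent N) (freqExponent B) {x | 0 < x.2.2}
      (freqAmplitude Q B s f) where
  aestronglyMeasurable_exponent := aestronglyMeasurable_freqExponent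
  aestronglyMeasurable := aestronglyMeasurable_freqAmplitude s hf
  exists_bound x hx n := by
    obtain ⟨M, hM0, hM⟩ := exists_norm_flow_pow_mul_exp_le hQ hK n
    -- Halving `w` gives a neighbourhood on which `e^{-w/τ}` has one majorant. The second summand of
    -- the bound, with `s + n` for `s`, accounts for `τ^{-n}`.
    have hw : 0 < x.2.2 / 2 := half_pos hx
    set w := x.2.2 / 2 with hwdef
    refine ⟨{y | w < y.2.2}, (isOpen_lt continuous_const (by fun_prop)).mem_nhds
      (by simp only [mem_ofPred_eq]; have : 0 < x.2.2 := hx; linarith),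
      fun a => weight s w a.1 * ((M + 1) * (‖f a.2‖ + ‖a.2‖ ^ n * ‖f a.2‖)) +
        weight (s + n) w a.1 * ‖f a.2‖, ?_, ?_⟩
    · refine Integrable.add ?_ ?_
      · exact Integrable.mul_prod (integrableOn_weight hs hw)
          ((hf.integrable_norm.add (hf.integrable_pow n)).const_mul (M + 1))
      · exact Integrable.mul_prod (integrableOn_weight (by positivity) hw) hf.integrable_norm
    · filter_upwards [ae_freqMeasure_pos] with a ha y hy
      have hy : w < y.2.2 := hy
      rw [exp_exponent_mul_freqAmplitude, norm_mul, norm_mul, norm_symbol, Complex.norm_real,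
        Real.norm_of_nonneg (weight_nonneg _ _ ha)]
      have hwle : weight s y.2.2 a.1 ≤ weight s w a.1 := by
        unfold weight; gcongr
      have hw0 := weight_nonneg s w ha
      set E := Real.exp (-(4 * Real.pi ^ 2 * accum Q B a.1 a.2.1)) with hE
      have hE0 : 0 < E := Real.exp_pos _
      have hE1 : E ≤ 1 := by
        have := norm_symbol_le_one (B := B) hQ ha.le a.2 0 0
        rwa [norm_symbol] at this
      have hp : ‖freqExponent B a‖ ^ n ≤ ‖flow B a.1 a.2.1‖ ^ n + ‖a.2‖ ^ n + a.1⁻¹ ^ n := by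
        have h1 : 0 ≤ ‖flow B a.1 a.2.1‖ ^ n := by positivity
        have h2 : 0 ≤ ‖a.2‖ ^ n := by positivity
        have h3 : 0 ≤ a.1⁻¹ ^ n := by positivity
        have h4 : ‖freqExponent B a‖ = max ‖flow B a.1 a.2.1‖ (max ‖a.2.2‖ ‖a.1⁻¹‖) := rfl
        have h5 : ‖a.1⁻¹‖ = a.1⁻¹ := Real.norm_of_nonneg (inv_nonneg.2 ha.le)
        have h6 : ‖a.2.2‖ ^ n ≤ ‖a.2‖ ^ n := pow_le_pow_left₀ (norm_nonneg _) (norm_snd_le a.2) n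
        rw [h4]
        rcases max_choice ‖flow B a.1 a.2.1‖ (max ‖a.2.2‖ ‖a.1⁻¹‖) with h | h <;> rw [h]
        · linarith
        · rcases max_choice ‖a.2.2‖ ‖a.1⁻¹‖ with h | h <;> rw [h]
          · linarith
          · rw [h5]; linarith
      have hflow : ‖flow B a.1 a.2.1‖ ^ n * E ≤ M * (1 + ‖a.2‖ ^ n) := by
        refine (hM a.1 ha a.2.1).trans ?_
        gcongr
        exact norm_fst_le a.2
      have hinv : weight s w a.1 * a.1⁻¹ ^ n = weight (s + n) w a.1 := by
        rw [weight, weight, show -1 - (s + n) = (-1 - s) + -(n : ℝ) by ring, Real.rpow_add ha,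
          Real.rpow_neg ha.le, Real.rpow_natCast, inv_pow]
        ring
      have key : ‖freqExponent B a‖ ^ n * E ≤ (M + 1) * (1 + ‖a.2‖ ^ n) + a.1⁻¹ ^ n := by
        have h2 : 0 ≤ ‖a.2‖ ^ n := by positivity
        have h3 : 0 ≤ a.1⁻¹ ^ n := by positivity
        calc _ ≤ (‖flow B a.1 a.2.1‖ ^ n + ‖a.2‖ ^ n + a.1⁻¹ ^ n) * E := by gcongr
          _ = ‖flow B a.1 a.2.1‖ ^ n * E + ‖a.2‖ ^ n * E + a.1⁻¹ ^ n * E := by ring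
          _ ≤ M * (1 + ‖a.2‖ ^ n) + ‖a.2‖ ^ n * 1 + a.1⁻¹ ^ n * 1 := by gcongr
          _ ≤ _ := by linarith
      calc _ = weight s y.2.2 a.1 * ((‖freqExponent B a‖ ^ n * E) * ‖f a.2‖) := by ring
        _ ≤ weight s w a.1 * (((M + 1) * (1 + ‖a.2‖ ^ n) + a.1⁻¹ ^ n) * ‖f a.2‖) := by gcongr
        _ = _ := by rw [← hinv]; ring

end Superposition

/-! ### The extension equation -/

section Equation

variable {N : ℕ} {Q B : Matrix (Fin N) (Fin N) ℝ}

/-- The logarithmic `τ`-derivative of the elementary solution with frequency `(ξ, θ)`. -/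
def logDerivative (Q B : Matrix (Fin N) (Fin N) ℝ) (s : ℝ) (x : Space N × ℝ × ℝ)
    (a : ℝ × Freq N) : ℂ :=
  (2 * Real.pi * Complex.I * (inner ℝ (matOp Bᵀ (flow B a.1 a.2.1)) x.1 - a.2.2 : ℝ) -
    (4 * Real.pi ^ 2 * qform Q (flow B a.1 a.2.1) : ℝ)) +
    (-(s + 1) * a.1⁻¹ + x.2.2 * a.1⁻¹ ^ 2 : ℝ)

/-- The bracket equals the effect of `𝒦` on the symbol, so this is the evolution equation `∂_τ P_τ =
𝒦 P_τ` on plane waves. -/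
lemma hasDerivAt_symbol (τ : ℝ) (v : Freq N) (X : Space N) (t : ℝ) :
    HasDerivAt (fun τ => symbol Q B τ v X t)
      ((2 * Real.pi * Complex.I * (inner ℝ (matOp Bᵀ (flow B τ v.1)) X - v.2 : ℝ) -
        (4 * Real.pi ^ 2 * qform Q (flow B τ v.1) : ℝ)) * symbol Q B τ v X t) τ := by
  have h1 : HasDerivAt (fun τ => flow B τ v.1) (matOp Bᵀ (flow B τ v.1)) τ :=
    ((ContinuousLinearMap.apply ℝ (Space N) v.1).hasFDerivAt.comp_hasDerivAt τ
      (hasDerivAt_flow B τ))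
  have h2 : HasDerivAt (fun τ => inner ℝ (flow B τ v.1) X)
      (inner ℝ (matOp Bᵀ (flow B τ v.1)) X) τ := by
    simpa using h1.inner ℝ (hasDerivAt_const τ X)
  have h3 : HasDerivAt (fun τ => inner ℝ (flow B τ v.1) X + v.2 * (t - τ))
      (inner ℝ (matOp Bᵀ (flow B τ v.1)) X - v.2) τ := by
    refine (h2.add (((hasDerivAt_id τ).const_sub t).const_mul v.2)).congr_deriv ?_
    ring
  have h4 := (hasDerivAt_accum Q B v.1 τ).const_mul (4 * Real.pi ^ 2)
  have h5 := ((h3.ofReal_comp.const_mul (2 * Real.pi * Complex.I)).sub h4.ofReal_comp).cexp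
  exact h5.congr_deriv (mul_comm _ _)

lemma hasDerivAt_elementary (s : ℝ) (f : Freq N → ℂ) (x : Space N × ℝ × ℝ) (v : Freq N) {τ : ℝ}
    (hτ : 0 < τ) :
    HasDerivAt (fun τ => (weight s x.2.2 τ : ℂ) * (symbol Q B τ v x.1 x.2.1 * f v))
      (logDerivative Q B s x (τ, v) *
        ((weight s x.2.2 τ : ℂ) * (symbol Q B τ v x.1 x.2.1 * f v))) τ := by
  refine ((hasDerivAt_weight s x.2.2 hτ).ofReal_comp.mul
    ((hasDerivAt_symbol τ v x.1 x.2.1).mul_const (f v))).congr_deriv ?_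
  rw [logDerivative]
  push_cast
  ring

/-- The integral of a total derivative: the weight kills the boundary values, by `e^{-w/τ}` at `0`
and by `τ^{-1-s}` at infinity, the symbol being bounded by one. -/
lemma integral_elementary_deriv (hQ : Q.PosSemidef) {s : ℝ} (hs : 0 < s) (f : Freq N → ℂ)
    {x : Space N × ℝ × ℝ} (hx : 0 < x.2.2) (v : Freq N)
    (hint : IntegrableOn (fun τ => logDerivative Q B s x (τ, v) *
        ((weight s x.2.2 τ : ℂ) * (symbol Q B τ v x.1 x.2.1 * f v))) (Ioi 0)) :
    ∫ τ in Ioi (0 : ℝ), logDerivative Q B s x (τ, v) *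
      ((weight s x.2.2 τ : ℂ) * (symbol Q B τ v x.1 x.2.1 * f v)) = 0 := by
  have hbound : ∀ τ, 0 < τ → ‖(weight s x.2.2 τ : ℂ) * (symbol Q B τ v x.1 x.2.1 * f v)‖ ≤
      weight s x.2.2 τ * ‖f v‖ := by
    intro τ hτ
    rw [norm_mul, norm_mul, Complex.norm_real, Real.norm_of_nonneg (weight_nonneg _ _ hτ)]
    have := weight_nonneg s x.2.2 hτ
    gcongr
    exact mul_le_of_le_one_left (norm_nonneg _) (norm_symbol_le_one hQ hτ.le _ _ _)
  -- The conventional value `0 ^ (-1 - s) = 0` agrees with the limit from the right, so the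
  -- primitive is continuous at the endpoint.
  have h0 : (weight s x.2.2 0 : ℂ) * (symbol Q B 0 v x.1 x.2.1 * f v) = 0 := by
    rw [weight, Real.zero_rpow (by linarith)]
    simp
  have h := integral_Ioi_of_hasDerivAt_of_tendsto (a := 0) (m := 0)
    (f := fun τ => (weight s x.2.2 τ : ℂ) * (symbol Q B τ v x.1 x.2.1 * f v)) ?_
    (fun τ hτ => hasDerivAt_elementary s f x v hτ) hint ?_
  · rw [h, h0, sub_zero]
  · rw [← continuousWithinAt_Ioi_iff_Ici, ContinuousWithinAt, h0]
    refine squeeze_zero_norm' ?_ (by simpa using (tendsto_weight_zero s hx).mul_const ‖f v‖)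
    filter_upwards [self_mem_nhdsWithin] with τ hτ using hbound τ hτ
  · refine squeeze_zero_norm' ?_ (by simpa using (tendsto_weight_atTop hs hx).mul_const ‖f v‖)
    filter_upwards [eventually_gt_atTop 0] with τ hτ using hbound τ hτ

lemma exponent_space (d : Space N × ℝ × ℝ) (i : Fin N) :
    exponent N d (EuclideanSpace.single i 1, 0, 0) = 2 * Real.pi * Complex.I * (d.1.ofLp i : ℝ) := by
  rw [exponent_apply]
  simp [EuclideanSpace.inner_single_right]

lemma exponent_time (d : Space N × ℝ × ℝ) :
    exponent N d (0, 1, 0) = 2 * Real.pi * Complex.I * (d.2.1 : ℝ) := by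
  rw [exponent_apply]
  simp

lemma exponent_extra (d : Space N × ℝ × ℝ) : exponent N d (0, 0, 1) = -(d.2.2 : ℝ) := by
  rw [exponent_apply]
  simp

/-- The left side is the multiplier of `𝒦 + w∂_ww + (s+1)∂_w` on one exponential. That it equals a
logarithmic `τ`-derivative is the algebra behind the extension equation. -/
lemma logDerivative_eq (s : ℝ) (x : Space N × ℝ × ℝ) (a : ℝ × Freq N) :
    (∑ i, ∑ j, (Q i j : ℂ) *
        (exponent N (freqExponent B a) (EuclideanSpace.single j 1, 0, 0) *
        exponent N (freqExponent B a) (EuclideanSpace.single i 1, 0, 0))) +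
      (∑ i, ((B *ᵥ x.1.ofLp) i : ℂ) *
        exponent N (freqExponent B a) (EuclideanSpace.single i 1, 0, 0)) -
      exponent N (freqExponent B a) (0, 1, 0) +
      ((x.2.2 : ℂ) * (exponent N (freqExponent B a) (0, 0, 1) *
        exponent N (freqExponent B a) (0, 0, 1)) +
      ((s + 1 : ℝ) : ℂ) * exponent N (freqExponent B a) (0, 0, 1)) =
    logDerivative Q B s x a := by
  simp only [exponent_space, exponent_time, exponent_extra, logDerivative, freqExponent]
  set η := flow B a.1 a.2.1
  have h1 : ∑ i, ∑ j, (Q i j : ℂ) * (2 * Real.pi * Complex.I * (η.ofLp j : ℝ) *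
      (2 * Real.pi * Complex.I * (η.ofLp i : ℝ))) = -(4 * Real.pi ^ 2 * qform Q η : ℝ) := by
    have h2 : ∀ i j, (Q i j : ℂ) * (2 * Real.pi * Complex.I * (η.ofLp j : ℝ) *
      (2 * Real.pi * Complex.I * (η.ofLp i : ℝ))) =
        (-(4 * Real.pi ^ 2 * (η.ofLp i * (Q i j * η.ofLp j))) : ℝ) := by
      intro i j
      push_cast
      linear_combination ((Q i j : ℂ) * (2 * Real.pi * (η.ofLp j : ℝ) *
        (2 * Real.pi * (η.ofLp i : ℝ)))) * Complex.I_sq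
    simp_rw [h2]
    rw [← Complex.ofReal_neg]
    simp only [← Complex.ofReal_sum]
    congr 1
    simp only [qform, dotProduct, Matrix.mulVec, Finset.mul_sum, Finset.sum_neg_distrib]
  have h3 : ∑ i, ((B *ᵥ x.1.ofLp) i : ℂ) * (2 * Real.pi * Complex.I * (η.ofLp i : ℝ)) =
      2 * Real.pi * Complex.I * (inner ℝ (matOp Bᵀ η) x.1 : ℝ) := by
    rw [← inner_matOp_transpose, inner_matOp, dotProduct]
    push_cast
    rw [Finset.mul_sum]
    exact Finset.sum_congr rfl fun i _ => by ring
  rw [h1, h3]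
  push_cast
  ring

lemma integral_combine {α : Type*} [MeasurableSpace α] {m : Measure α} {f₁ f₂ f₃ f₄ f₅ : α → ℂ}
    (h₁ : Integrable f₁ m) (h₂ : Integrable f₂ m) (h₃ : Integrable f₃ m) (h₄ : Integrable f₄ m)
    (h₅ : Integrable f₅ m) :
    (∫ a, f₁ a ∂m) + (∫ a, f₂ a ∂m) - (∫ a, f₃ a ∂m) + ((∫ a, f₄ a ∂m) + ∫ a, f₅ a ∂m) =
      ∫ a, (f₁ a + f₂ a - f₃ a + (f₄ a + f₅ a)) ∂m := by
  have h := integral_add ((h₁.add h₂).sub h₃) (h₄.add h₅)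
  simp only [Pi.add_apply, Pi.sub_apply] at h
  have h' := integral_sub (h₁.add h₂) h₃
  simp only [Pi.add_apply] at h'
  rw [h, h', integral_add h₁ h₂, integral_add h₄ h₅]

/-- The superposition of elementary solutions is annihilated by `𝒦 + w ∂_ww + (s+1) ∂_w`. -/
lemma expIntegral_equation (hQ : Q.PosSemidef) (hK : (covariance Q B 1).PosDef) {s : ℝ}
    (hs : 0 < s) {f : Freq N → ℂ} (hf : HasMoments f) {x : Space N × ℝ × ℝ} (hx : 0 < x.2.2)
    {J : (ℝ × Freq N → ℂ) → ℂ}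
    (hJ : J = fun k => expIntegral (freqMeasure N) (exponent N) (freqExponent B) k x)
    {ℓ : Space N × ℝ × ℝ → ℝ × Freq N → ℂ} (hℓ : ℓ = fun h a => exponent N (freqExponent B a) h)
    {k : ℝ × Freq N → ℂ} (hk : k = freqAmplitude Q B s f) :
    (∑ i, ∑ j, (Q i j : ℂ) * J (fun a => ℓ (EuclideanSpace.single j 1, 0, 0) a *
        (ℓ (EuclideanSpace.single i 1, 0, 0) a * k a))) +
      (∑ i, ((B *ᵥ x.1.ofLp) i : ℂ) * J (fun a => ℓ (EuclideanSpace.single i 1, 0, 0) a * k a)) -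
      J (fun a => ℓ (0, 1, 0) a * k a) +
      ((x.2.2 : ℂ) * J (fun a => ℓ (0, 0, 1) a * (ℓ (0, 0, 1) a * k a)) +
      ((s + 1 : ℝ) : ℂ) * J (fun a => ℓ (0, 0, 1) a * k a)) = 0 := by
  have hgood := expIntegrable_freq hQ hK hs hf
  have hx' : x ∈ {x : Space N × ℝ × ℝ | 0 < x.2.2} := hx
  have h1 (h) : Integrable (fun a => Complex.exp (exponent N (freqExponent B a) x) *
      (ℓ h a * k a)) (freqMeasure N) := by
    subst hℓ hk
    exact (hgood.mul h).integrable hx'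
  have h2 (h h') : Integrable (fun a => Complex.exp (exponent N (freqExponent B a) x) *
      (ℓ h a * (ℓ h' a * k a))) (freqMeasure N) := by
    subst hℓ hk
    exact ((hgood.mul h').mul h).integrable hx'
  have hA : Integrable (fun a => ∑ i, ∑ j, (Q i j : ℂ) *
      (Complex.exp (exponent N (freqExponent B a) x) *
        (ℓ (EuclideanSpace.single j 1, 0, 0) a * (ℓ (EuclideanSpace.single i 1, 0, 0) a * k a))))
      (freqMeasure N) :=
    integrable_finsetSum _ fun i _ => integrable_finsetSum _ fun j _ => (h2 _ _).const_mul _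
  have hB : Integrable (fun a => ∑ i, ((B *ᵥ x.1.ofLp) i : ℂ) *
      (Complex.exp (exponent N (freqExponent B a) x) *
        (ℓ (EuclideanSpace.single i 1, 0, 0) a * k a))) (freqMeasure N) :=
    integrable_finsetSum _ fun i _ => (h1 _).const_mul _
  have hT := h1 (0, 1, 0)
  have hW := (h2 (0, 0, 1) (0, 0, 1)).const_mul (x.2.2 : ℂ)
  have hW' := (h1 (0, 0, 1)).const_mul ((s + 1 : ℝ) : ℂ)
  have hsum : (∑ i, ∑ j, (Q i j : ℂ) * J (fun a => ℓ (EuclideanSpace.single j 1, 0, 0) a *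
        (ℓ (EuclideanSpace.single i 1, 0, 0) a * k a))) =
      ∫ a, ∑ i, ∑ j, (Q i j : ℂ) * (Complex.exp (exponent N (freqExponent B a) x) *
        (ℓ (EuclideanSpace.single j 1, 0, 0) a * (ℓ (EuclideanSpace.single i 1, 0, 0) a * k a)))
        ∂(freqMeasure N) := by
    rw [integral_finsetSum _ fun i _ => integrable_finsetSum _ fun j _ => (h2 _ _).const_mul _]
    refine Finset.sum_congr rfl fun i _ => ?_
    rw [integral_finsetSum _ fun j _ => (h2 _ _).const_mul _]
    refine Finset.sum_congr rfl fun j _ => ?_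
    rw [integral_const_mul, hJ]; rfl
  have hsum' : (∑ i, ((B *ᵥ x.1.ofLp) i : ℂ) *
        J (fun a => ℓ (EuclideanSpace.single i 1, 0, 0) a * k a)) =
      ∫ a, ∑ i, ((B *ᵥ x.1.ofLp) i : ℂ) * (Complex.exp (exponent N (freqExponent B a) x) *
        (ℓ (EuclideanSpace.single i 1, 0, 0) a * k a)) ∂(freqMeasure N) := by
    rw [integral_finsetSum _ fun i _ => (h1 _).const_mul _]
    refine Finset.sum_congr rfl fun i _ => ?_
    rw [integral_const_mul, hJ]; rfl
  have htot : ∀ a, (((∑ i, ∑ j, (Q i j : ℂ) * (Complex.exp (exponent N (freqExponent B a) x) *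
        (ℓ (EuclideanSpace.single j 1, 0, 0) a * (ℓ (EuclideanSpace.single i 1, 0, 0) a * k a)))) +
      (∑ i, ((B *ᵥ x.1.ofLp) i : ℂ) * (Complex.exp (exponent N (freqExponent B a) x) *
        (ℓ (EuclideanSpace.single i 1, 0, 0) a * k a)))) -
      Complex.exp (exponent N (freqExponent B a) x) * (ℓ (0, 1, 0) a * k a)) +
      ((x.2.2 : ℂ) * (Complex.exp (exponent N (freqExponent B a) x) *
        (ℓ (0, 0, 1) a * (ℓ (0, 0, 1) a * k a))) +
      ((s + 1 : ℝ) : ℂ) * (Complex.exp (exponent N (freqExponent B a) x) *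
        (ℓ (0, 0, 1) a * k a))) =
      logDerivative Q B s x a * ((weight s x.2.2 a.1 : ℂ) *
        (symbol Q B a.1 a.2 x.1 x.2.1 * f a.2)) := by
    intro a
    rw [← exp_exponent_mul_freqAmplitude (B := B), ← logDerivative_eq, ← hk]
    subst hℓ
    simp only [add_mul, sub_mul, Finset.sum_mul]
    congr 1
    · congr 1
      · congr 1
        · exact Finset.sum_congr rfl fun i _ => Finset.sum_congr rfl fun j _ => by ring
        · exact Finset.sum_congr rfl fun i _ => by ring
      · ring
    · ring
  have hI := ((hA.add hB).sub hT).add (hW.add hW')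
  rw [hsum, hsum']
  have e1 : J (fun a => ℓ (0, 1, 0) a * k a) = ∫ a, Complex.exp (exponent N (freqExponent B a) x) *
      (ℓ (0, 1, 0) a * k a) ∂(freqMeasure N) := by rw [hJ]; rfl
  have e2 : (x.2.2 : ℂ) * J (fun a => ℓ (0, 0, 1) a * (ℓ (0, 0, 1) a * k a)) =
      ∫ a, (x.2.2 : ℂ) * (Complex.exp (exponent N (freqExponent B a) x) *
        (ℓ (0, 0, 1) a * (ℓ (0, 0, 1) a * k a))) ∂(freqMeasure N) := by
    rw [integral_const_mul, hJ]; rfl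
  have e3 : ((s + 1 : ℝ) : ℂ) * J (fun a => ℓ (0, 0, 1) a * k a) =
      ∫ a, ((s + 1 : ℝ) : ℂ) * (Complex.exp (exponent N (freqExponent B a) x) *
        (ℓ (0, 0, 1) a * k a)) ∂(freqMeasure N) := by
    rw [integral_const_mul, hJ]; rfl
  rw [e1, e2, e3, integral_combine hA hB hT hW hW']
  have hI' := hI.congr (ae_of_all _ htot)
  rw [integral_congr_ae (ae_of_all _ htot)]
  rw [freqMeasure] at hI' ⊢
  -- Integrating in `τ` first, at fixed frequency, leaves a total derivative.
  rw [integral_prod_symm _ hI']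
  refine integral_eq_zero_of_ae ?_
  filter_upwards [hI'.prod_left_ae] with v hv
  exact integral_elementary_deriv hQ hs f hx v hv

end Equation

/-! ### Uniform estimate of `P_τ u - u` -/

section Difference

variable {N : ℕ} {𝕜 : Type*} [RCLike 𝕜] {Q B : Matrix (Fin N) (Fin N) ℝ}

lemma exists_norm_schwartz_le (u : 𝓢(Space N × ℝ, 𝕜)) : ∃ C, 0 ≤ C ∧ ∀ q, ‖u q‖ ≤ C := by
  obtain ⟨C, hC, h⟩ := u.decay 0 0
  exact ⟨C, hC.le, fun q => by simpa using h q⟩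

lemma flow_transpose (B : Matrix (Fin N) (Fin N) ℝ) (τ : ℝ) (X : Space N) :
    flow Bᵀ τ X = matOp (NormedSpace.exp (τ • B)) X := by
  rw [← matOp_exp_transpose, Matrix.transpose_transpose]

/-- A Schwartz function varies at a bounded rate along the drift `σ ↦ (e^{σB}X, t-σ)`. -/
lemma exists_norm_sub_drift_le (B : Matrix (Fin N) (Fin N) ℝ) (u : 𝓢(Space N × ℝ, 𝕜)) :
    ∃ C, 0 ≤ C ∧ ∀ τ, 0 ≤ τ → ∀ X t, ‖u (flow Bᵀ τ X, t - τ) - u (X, t)‖ ≤ C * τ := by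
  -- The drift field `(BX, -1)` grows linearly, so both `∇u` and `‖q‖∇u` must be bounded for a rate
  -- uniform in `X`.
  obtain ⟨C0, hC0, h0⟩ := u.decay 0 1
  obtain ⟨C1, hC1, h1⟩ := u.decay 1 1
  refine ⟨‖matOp B‖ * C1 + C0, by positivity, fun τ hτ X t => ?_⟩
  have hγ (σ : ℝ) : HasDerivAt (fun σ => (flow Bᵀ σ X, t - σ))
      (matOp B (flow Bᵀ σ X), (-1 : ℝ)) σ := by
    have h2 : HasDerivAt (fun σ => flow Bᵀ σ X) (matOp B (flow Bᵀ σ X)) σ := by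
      have := (ContinuousLinearMap.apply ℝ (Space N) X).hasFDerivAt.comp_hasDerivAt σ
        (hasDerivAt_flow Bᵀ σ)
      rwa [Matrix.transpose_transpose] at this
    exact h2.prodMk ((hasDerivAt_id σ).const_sub t)
  have hd (σ : ℝ) : HasDerivAt (fun σ => u (flow Bᵀ σ X, t - σ))
      (fderiv ℝ u (flow Bᵀ σ X, t - σ) (matOp B (flow Bᵀ σ X), (-1 : ℝ))) σ :=
    (u.differentiableAt (x := (flow Bᵀ σ X, t - σ))).hasFDerivAt.comp_hasDerivAt σ (hγ σ)
  have h := norm_image_sub_le_of_norm_deriv_le_segment' (a := 0) (b := τ)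
    (f := fun σ => u (flow Bᵀ σ X, t - σ)) (C := ‖matOp B‖ * C1 + C0)
    (fun σ _ => (hd σ).hasDerivWithinAt) (fun σ _ => ?_) τ ⟨hτ, le_rfl⟩
  · simpa using h
  · set q : Space N × ℝ := (flow Bᵀ σ X, t - σ) with hq
    have e0 : ‖fderiv ℝ u q‖ ≤ C0 := by
      simpa [norm_iteratedFDeriv_one] using h0 q
    have e1 : ‖q‖ * ‖fderiv ℝ u q‖ ≤ C1 := by
      simpa [norm_iteratedFDeriv_one] using h1 q
    have e2 : ‖(matOp B (flow Bᵀ σ X), (-1 : ℝ))‖ ≤ ‖matOp B‖ * ‖q‖ + 1 := by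
      refine max_le ?_ ?_
      · have h3 : ‖matOp B (flow Bᵀ σ X)‖ ≤ ‖matOp B‖ * ‖q‖ :=
          ((matOp B).le_opNorm _).trans (by gcongr; exact norm_fst_le q)
        exact h3.trans (by linarith)
      · have : 0 ≤ ‖matOp B‖ * ‖q‖ := by positivity
        simpa using this
    calc _ ≤ ‖fderiv ℝ u q‖ * ‖(matOp B (flow Bᵀ σ X), (-1 : ℝ))‖ :=
          ContinuousLinearMap.le_opNorm _ _
      _ ≤ ‖fderiv ℝ u q‖ * (‖matOp B‖ * ‖q‖ + 1) := by gcongr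
      _ = ‖matOp B‖ * (‖q‖ * ‖fderiv ℝ u q‖) + ‖fderiv ℝ u q‖ := by ring
      _ ≤ _ := by gcongr

/-- Separates transport along the drift from diffusive damping; the two are estimated by different
means. -/
lemma symbol_eq_wave_mul (τ : ℝ) (v : Freq N) (X : Space N) (t : ℝ) :
    symbol Q B τ v X t = wave v (flow Bᵀ τ X) (t - τ) *
      (Real.exp (-(4 * Real.pi ^ 2 * accum Q B τ v.1)) : ℂ) := by
  rw [symbol, wave, Complex.ofReal_exp, ← Complex.exp_add, flow_transpose]
  congr 1
  rw [show inner ℝ v.1 (matOp (NormedSpace.exp (τ • B)) X) = inner ℝ (flow B τ v.1) X from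
    inner_exp_smul B τ v.1 X]
  push_cast
  ring

/-- For small `τ`, `P_τ u` is compared with `u` carried along the drift, and that with `u`; both
errors are `O(τ)`. For large `τ` boundedness suffices. The linear rate makes `τ^{-1-s}(P_τ u - u)`
integrable at zero. -/
lemma exists_norm_semigroup_sub_le (hQ : Q.PosSemidef)
    (hK : ∀ t : ℝ, 0 < t → (covariance Q B t).PosDef) (u : 𝓢(Space N × ℝ, 𝕜))
    {f : Freq N → ℂ} (hfm : HasMoments f)
    (hf : ∀ Y r, u (Y, r) = ofC (∫ v : Freq N, wave v Y r * f v)) :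
    ∃ C, 0 ≤ C ∧ ∀ τ, 0 < τ → ∀ X t,
      ‖evolutiveSemigroup Q B τ u X t - u (X, t)‖ ≤ C * min τ 1 := by
  obtain ⟨C, hC, hdrift⟩ := exists_norm_sub_drift_le B u
  obtain ⟨M, hM, hacc⟩ := exists_accum_le (Q := Q) B
  set A := ∫ v : Freq N, ‖v‖ ^ 2 * ‖f v‖ with hA
  set A0 := ∫ v : Freq N, ‖f v‖ with hA0
  have hAn : 0 ≤ A := integral_nonneg fun v => by positivity
  have hA0n : 0 ≤ A0 := integral_nonneg fun v => by positivity
  set P := ‖(ofC : ℂ →L[ℝ] 𝕜)‖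
  refine ⟨P * (4 * Real.pi ^ 2 * M * A) + C + P * (A0 + A0), by positivity, fun τ hτ X t => ?_⟩
  rw [evolutiveSemigroup_eq hfm hf hτ (hK τ hτ)]
  rcases le_total τ 1 with h1 | h1
  · rw [min_eq_left h1]
    -- The diffusive error: `1 - e^{-x} ≤ x` with `x = O(τ‖ξ‖²)`, integrated against the second
    -- moment of `f`.
    have e1 : ‖ofC (∫ v : Freq N, symbol Q B τ v X t * f v) - u (flow Bᵀ τ X, t - τ)‖ ≤
        P * (4 * Real.pi ^ 2 * M * A) * τ := by
      rw [hf, ← map_sub, ← integral_sub (integrable_symbol_mul hQ hfm hτ.le X t)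
        (integrable_wave_mul hfm _ _)]
      refine (ContinuousLinearMap.le_opNorm _ _).trans ?_
      rw [mul_assoc]
      refine mul_le_mul_of_nonneg_left ?_ (norm_nonneg _)
      rw [show 4 * Real.pi ^ 2 * M * A * τ = ∫ v : Freq N, (4 * Real.pi ^ 2 * M * τ) *
        (‖v‖ ^ 2 * ‖f v‖) by rw [integral_const_mul]; ring]
      refine norm_integral_le_of_norm_le ((hfm.integrable_pow 2).const_mul _)
        (ae_of_all _ fun v => ?_)
      have ha : 0 ≤ 4 * Real.pi ^ 2 * accum Q B τ v.1 := by
        have := accum_nonneg hQ B hτ.le v.1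
        positivity
      rw [← sub_mul, norm_mul, symbol_eq_wave_mul, ← mul_sub_one, norm_mul, norm_wave, one_mul,
        ← Complex.ofReal_one, ← Complex.ofReal_sub, Complex.norm_real, Real.norm_eq_abs,
        abs_sub_comm, abs_of_nonneg (by simpa using ha), ← mul_assoc]
      gcongr
      have e2 := Real.add_one_le_exp (-(4 * Real.pi ^ 2 * accum Q B τ v.1))
      have e3 := hacc τ ⟨hτ.le, h1⟩ v.1
      calc _ ≤ 4 * Real.pi ^ 2 * accum Q B τ v.1 := by linarith
        _ ≤ 4 * Real.pi ^ 2 * (M * τ * ‖v‖ ^ 2) := by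
          gcongr
          refine e3.trans ?_
          gcongr
          exact norm_fst_le v
        _ = _ := by ring
    have e2 := hdrift τ hτ.le X t
    have e3 : 0 ≤ P * (A0 + A0) * τ := by positivity
    calc _ ≤ ‖ofC (∫ v : Freq N, symbol Q B τ v X t * f v) - u (flow Bᵀ τ X, t - τ)‖ +
          ‖u (flow Bᵀ τ X, t - τ) - u (X, t)‖ := norm_sub_le_norm_sub_add_norm_sub _ _ _
      _ ≤ _ := by linarith
  · rw [min_eq_right h1, mul_one]
    have e1 : ‖ofC (∫ v : Freq N, symbol Q B τ v X t * f v) - u (X, t)‖ ≤ P * (A0 + A0) := by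
      rw [hf, ← map_sub]
      refine (ContinuousLinearMap.le_opNorm _ _).trans ?_
      refine mul_le_mul_of_nonneg_left ((norm_sub_le _ _).trans (add_le_add ?_ ?_)) (norm_nonneg _)
      · refine norm_integral_le_of_norm_le hfm.integrable_norm (ae_of_all _ fun v => ?_)
        rw [norm_mul]
        exact mul_le_of_le_one_left (norm_nonneg _) (norm_symbol_le_one hQ hτ.le _ _ _)
      · refine norm_integral_le_of_norm_le hfm.integrable_norm (ae_of_all _ fun v => ?_)
        rw [norm_mul, norm_wave, one_mul]
    have : 0 ≤ P * (4 * Real.pi ^ 2 * M * A) + C := by positivity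
    linarith

lemma continuous_semigroup (hQ : Q.PosSemidef)
    (hK : ∀ t : ℝ, 0 < t → (covariance Q B t).PosDef) (u : 𝓢(Space N × ℝ, 𝕜))
    {f : Freq N → ℂ} (hfm : HasMoments f)
    (hf : ∀ Y r, u (Y, r) = ofC (∫ v : Freq N, wave v Y r * f v)) {τ : ℝ} (hτ : 0 < τ) :
    Continuous fun q : Space N × ℝ => evolutiveSemigroup Q B τ u q.1 q.2 := by
  have h1 : (fun q : Space N × ℝ => evolutiveSemigroup Q B τ u q.1 q.2) =
      fun q => ofC (∫ v : Freq N, symbol Q B τ v q.1 q.2 * f v) :=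
    funext fun q => evolutiveSemigroup_eq hfm hf hτ (hK τ hτ) q.1 q.2
  rw [h1]
  refine ofC.continuous.comp ?_
  refine continuous_of_dominated
    (fun q => (integrable_symbol_mul hQ hfm hτ.le q.1 q.2).aestronglyMeasurable)
    (fun q => ae_of_all _ fun v => ?_) hfm.integrable_norm (ae_of_all _ fun v => ?_)
  · rw [norm_mul]
    exact mul_le_of_le_one_left (norm_nonneg _) (norm_symbol_le_one hQ hτ.le _ _ _)
  · exact (continuous_symbol continuous_const continuous_const continuous_fst
      continuous_snd).mul continuous_const

/-- The Fourier integrand is jointly continuous in `τ` and the frequency, whereas the kernel itself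
is singular as `τ → 0`. -/
lemma aestronglyMeasurable_semigroup (hK : ∀ t : ℝ, 0 < t → (covariance Q B t).PosDef)
    (u : 𝓢(Space N × ℝ, 𝕜)) {f : Freq N → ℂ} (hfm : HasMoments f)
    (hf : ∀ Y r, u (Y, r) = ofC (∫ v : Freq N, wave v Y r * f v)) (X : Space N) (t : ℝ) :
    AEStronglyMeasurable (fun τ => evolutiveSemigroup Q B τ u X t)
      (volume.restrict (Ioi (0 : ℝ))) := by
  have h1 : Continuous (Function.uncurry fun (τ : ℝ) (v : Freq N) => symbol Q B τ v X t * f v) :=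
    (continuous_symbol continuous_fst continuous_snd continuous_const continuous_const).mul
      (hfm.continuous.comp continuous_snd)
  have h2 := h1.stronglyMeasurable.integral_prod_right (ν := (volume : Measure (Freq N)))
  refine ((ofC (𝕜 := 𝕜)).continuous.comp_stronglyMeasurable h2).aestronglyMeasurable.congr ?_
  filter_upwards [ae_restrict_mem measurableSet_Ioi] with τ hτ
  exact (evolutiveSemigroup_eq hfm hf hτ (hK τ hτ) X t).symm

end Difference

/-! ### Weighted averages of `P_τ u - u` against `τ^{-1-s}` -/

section WeightedAverage

variable {N : ℕ} {𝕜 : Type*} [RCLike 𝕜] {s : ℝ}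

/-- The majorant `τ^{-1-s} min(τ, 1)`. -/
def majorant (s τ : ℝ) : ℝ := τ ^ (-1 - s) * min τ 1

lemma majorant_nonneg (s : ℝ) {τ : ℝ} (hτ : 0 < τ) : 0 ≤ majorant s τ := by
  unfold majorant; positivity

/-- Near zero the majorant is `τ^{-s}`, which needs `s < 1`; at infinity it is `τ^{-1-s}`, which
needs `s > 0`. -/
lemma integrableOn_majorant (hs0 : 0 < s) (hs1 : s < 1) : IntegrableOn (majorant s) (Ioi 0) := by
  rw [← Ioc_union_Ioi_eq_Ioi zero_le_one]
  refine IntegrableOn.union ?_ ?_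
  · have h := (intervalIntegral.intervalIntegrable_rpow' (a := 0) (b := 1) (r := -s)
      (by linarith)).1
    refine h.congr_fun (fun τ hτ => ?_) measurableSet_Ioc
    simp only [majorant]
    rw [min_eq_left hτ.2, ← Real.rpow_add_one hτ.1.ne']
    congr 1
    ring
  · have h := integrableOn_Ioi_rpow_of_lt (a := -1 - s) (by linarith) one_pos
    refine h.congr_fun (fun τ hτ => ?_) measurableSet_Ioi
    simp only [majorant]
    rw [min_eq_right (le_of_lt hτ), mul_one]

variable {T : ℝ → Space N × ℝ → 𝕜} {v : Space N × ℝ → 𝕜} {C : ℝ} {w : ℝ → ℝ} {K : ℝ}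

lemma norm_weighted_le (hT : ∀ τ, 0 < τ → ∀ q, ‖T τ q - v q‖ ≤ C * min τ 1)
    {τ : ℝ} (hτ : 0 < τ) (q : Space N × ℝ) :
    ‖(τ ^ (-1 - s) * w τ) • (T τ q - v q)‖ ≤ C * (majorant s τ * |w τ|) := by
  rw [norm_smul, norm_mul, Real.norm_of_nonneg (by positivity : 0 ≤ τ ^ (-1 - s)),
    Real.norm_eq_abs]
  calc _ ≤ τ ^ (-1 - s) * |w τ| * (C * min τ 1) := by gcongr; exact hT τ hτ q
    _ = _ := by rw [majorant]; ring

lemma integrableOn_majorant_mul (hs0 : 0 < s) (hs1 : s < 1) (hw : Measurable w)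
    (hK : ∀ τ, 0 < τ → |w τ| ≤ K) :
    IntegrableOn (fun τ => majorant s τ * |w τ|) (Ioi 0) := by
  refine ((integrableOn_majorant hs0 hs1).mul_const K).mono' ?_ ?_
  · exact (integrableOn_majorant hs0 hs1).aestronglyMeasurable.mul
      (hw.abs).aestronglyMeasurable
  · filter_upwards [ae_restrict_mem measurableSet_Ioi] with τ hτ
    have hm := majorant_nonneg s hτ
    rw [Real.norm_of_nonneg (by positivity)]
    gcongr
    exact hK τ hτ

lemma integrableOn_weighted (hs0 : 0 < s) (hs1 : s < 1) (hw : Measurable w)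
    (hK : ∀ τ, 0 < τ → |w τ| ≤ K) (hT : ∀ τ, 0 < τ → ∀ q, ‖T τ q - v q‖ ≤ C * min τ 1)
    {q : Space N × ℝ} (hTm : AEStronglyMeasurable (fun τ => T τ q) (volume.restrict (Ioi 0))) :
    IntegrableOn (fun τ => (τ ^ (-1 - s) * w τ) • (T τ q - v q)) (Ioi 0) := by
  refine ((integrableOn_majorant_mul hs0 hs1 hw hK).const_mul C).mono' ?_ ?_
  · have h : Measurable fun τ : ℝ => τ ^ (-1 - s) * w τ := by fun_prop
    exact h.aestronglyMeasurable.smul (hTm.sub aestronglyMeasurable_const)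
  · filter_upwards [ae_restrict_mem measurableSet_Ioi] with τ hτ
    exact norm_weighted_le hT hτ q

/-- Continuity in `(X,t)` provides the measurability needed for membership in `L^∞`. -/
lemma continuous_weighted (hs0 : 0 < s) (hs1 : s < 1) (hw : Measurable w)
    (hK : ∀ τ, 0 < τ → |w τ| ≤ K) (hT : ∀ τ, 0 < τ → ∀ q, ‖T τ q - v q‖ ≤ C * min τ 1)
    (hTm : ∀ q, AEStronglyMeasurable (fun τ => T τ q) (volume.restrict (Ioi 0)))
    (hTc : ∀ τ, 0 < τ → Continuous (T τ)) (hv : Continuous v) :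
    Continuous fun q => ∫ τ in Ioi (0 : ℝ), (τ ^ (-1 - s) * w τ) • (T τ q - v q) := by
  refine continuous_of_dominated
    (fun q => (integrableOn_weighted hs0 hs1 hw hK hT (hTm q)).aestronglyMeasurable)
    (fun q => ?_) ((integrableOn_majorant_mul hs0 hs1 hw hK).const_mul C) ?_
  · filter_upwards [ae_restrict_mem measurableSet_Ioi] with τ hτ
    exact norm_weighted_le hT hτ q
  · filter_upwards [ae_restrict_mem measurableSet_Ioi] with τ hτ
    exact continuous_const.smul ((hTc τ hτ).sub hv)

lemma norm_integral_weighted_le (hs0 : 0 < s) (hs1 : s < 1) (hw : Measurable w)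
    (hK : ∀ τ, 0 < τ → |w τ| ≤ K) (hT : ∀ τ, 0 < τ → ∀ q, ‖T τ q - v q‖ ≤ C * min τ 1)
    (q : Space N × ℝ) :
    ‖∫ τ in Ioi (0 : ℝ), (τ ^ (-1 - s) * w τ) • (T τ q - v q)‖ ≤
      C * ∫ τ in Ioi (0 : ℝ), majorant s τ * |w τ| := by
  rw [← integral_const_mul]
  refine norm_integral_le_of_norm_le ((integrableOn_majorant_mul hs0 hs1 hw hK).const_mul C) ?_
  filter_upwards [ae_restrict_mem measurableSet_Ioi] with τ hτ
  exact norm_weighted_le hT hτ q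

end WeightedAverage

/-! ### Normalisation of the Bessel kernel -/

section Bessel

/-- The normalising constant of the Bessel kernel. -/
def besselConst (s : ℝ) : ℝ := 1 / ((2 : ℝ) ^ (2 * s) * Real.Gamma s)

lemma besselKernel_eq {s : ℝ} (z : ℝ) {τ : ℝ} (hτ : 0 < τ) :
    besselKernel (1 - 2 * s) z τ = besselConst s * z ^ (2 * s) * weight s (z ^ 2 / 4) τ := by
  rw [besselKernel, besselConst, weight, show 1 - (1 - 2 * s) = 2 * s by ring,
    show 2 * s / 2 = s by ring, show (3 - (1 - 2 * s)) / 2 = 1 + s by ring,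
    show -1 - s = -(1 + s) by ring, Real.rpow_neg hτ.le]
  rw [show -z ^ 2 / (4 * τ) = -(z ^ 2 / 4 / τ) by field_simp]
  ring

lemma besselConst_pos {s : ℝ} (hs : 0 < s) : 0 < besselConst s := by
  have := Real.Gamma_pos_of_pos hs
  unfold besselConst; positivity

/-- This says that `g^{(a)}(z,·)` has total mass one on `(0,∞)`. -/
lemma besselConst_mul_rpow_mul {s z : ℝ} (hs : 0 < s) (hz : 0 < z) :
    besselConst s * z ^ (2 * s) * ((1 / (z ^ 2 / 4)) ^ s * Real.Gamma s) = 1 := by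
  have hΓ := Real.Gamma_pos_of_pos hs
  have h2 : (2 : ℝ) ^ (2 * s) = 4 ^ s := by
    rw [Real.rpow_mul (by norm_num)]; norm_num
  have h3 : z ^ (2 * s) = (z ^ 2) ^ s := by
    rw [Real.rpow_mul hz.le]; norm_num
  have h4 : (1 / (z ^ 2 / 4)) ^ s = 4 ^ s / (z ^ 2) ^ s := by
    rw [one_div_div, Real.div_rpow (by norm_num) (by positivity)]
  have h5 : 0 < (z ^ 2) ^ s := by positivity
  have h6 : 0 < (4 : ℝ) ^ s := by positivity
  rw [besselConst, h2, h3, h4]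
  field_simp

/-- An instance of `Γ(s+1) = sΓ(s)`, equivalent to the mass of `g^{(a)}(z,·)` not depending on `z`.
-/
lemma integral_weight_add_one {s w : ℝ} (hs : 0 < s) (hw : 0 < w) :
    w * ∫ τ in Ioi (0 : ℝ), weight (s + 1) w τ = s * ∫ τ in Ioi (0 : ℝ), weight s w τ := by
  rw [integral_weight (by linarith) hw, integral_weight hs hw, Real.Gamma_add_one hs.ne',
    Real.rpow_add_one (by positivity)]
  field_simp

lemma weight_add_one (s w : ℝ) {τ : ℝ} (hτ : 0 < τ) : weight (s + 1) w τ = τ⁻¹ * weight s w τ := by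
  rw [weight, weight, show -1 - (s + 1) = (-1 - s) - 1 by ring, Real.rpow_sub_one hτ.ne']
  ring

end Bessel

/-! ### From the Poisson integral to the superposition -/

section Extension

variable {N : ℕ} {𝕜 : Type*} [RCLike 𝕜] {Q B : Matrix (Fin N) (Fin N) ℝ}

/-- The reflection `τ ↦ t - τ`, which relates the two expressions for `U`. -/
lemma measurePreserving_restrict_sub_left (t : ℝ) :
    MeasurePreserving (fun τ : ℝ => t - τ) (volume.restrict (Iio t)) (volume.restrict (Ioi 0)) := by
  have h := (Measure.measurePreserving_sub_left (volume : Measure ℝ) t).restrict_preimage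
    (measurableSet_Ioi (a := (0 : ℝ)))
  have he : (fun τ : ℝ => t - τ) ⁻¹' Ioi 0 = Iio t := by
    ext τ; simp
  rwa [he] at h

lemma measurableEmbedding_sub_left (t : ℝ) : MeasurableEmbedding (fun τ : ℝ => t - τ) :=
  (Homeomorph.subLeft t).measurableEmbedding

lemma extension_eq_integral_Ioi (a : ℝ) (u : Space N × ℝ → 𝕜) (X : Space N) (t z : ℝ) :
    extension Q B a u X t z =
      ∫ τ in Ioi (0 : ℝ), ∫ Y : Space N, poissonKernel Q B a z X Y τ • u (Y, t - τ) := by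
  rw [extension, ← (measurePreserving_restrict_sub_left t).integral_comp
    (measurableEmbedding_sub_left t)]
  simp

lemma extension_eq_semigroup (a : ℝ) (u : Space N × ℝ → 𝕜) (X : Space N) (t z : ℝ) :
    extension Q B a u X t z =
      ∫ τ in Ioi (0 : ℝ), besselKernel a z τ • evolutiveSemigroup Q B τ u X t := by
  rw [extension_eq_integral_Ioi]
  congr 1
  ext τ
  rw [evolutiveSemigroup, ← integral_smul]
  simp only [poissonKernel, mul_smul]

/-- Integrating out the frequencies in a superposition of elementary solutions. -/
lemma ofC_expIntegral (hK : ∀ t : ℝ, 0 < t → (covariance Q B t).PosDef)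
    {u : 𝓢(Space N × ℝ, 𝕜)} {f : Freq N → ℂ} (hfm : HasMoments f)
    (hf : ∀ Y r, u (Y, r) = ofC (∫ v : Freq N, wave v Y r * f v)) (s : ℝ)
    {x : Space N × ℝ × ℝ} (r : ℝ → ℝ)
    (hint : Integrable (fun a => Complex.exp (exponent N (freqExponent B a) x) *
      ((r a.1 : ℂ) * freqAmplitude Q B s f a)) (freqMeasure N)) :
    IntegrableOn (fun τ => (r τ * weight s x.2.2 τ) • evolutiveSemigroup Q B τ u x.1 x.2.1)
      (Ioi 0) ∧
    ofC (expIntegral (freqMeasure N) (exponent N) (freqExponent B)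
      (fun a => (r a.1 : ℂ) * freqAmplitude Q B s f a) x) =
    ∫ τ in Ioi (0 : ℝ), (r τ * weight s x.2.2 τ) • evolutiveSemigroup Q B τ u x.1 x.2.1 := by
  have he : ∀ a : ℝ × Freq N, Complex.exp (exponent N (freqExponent B a) x) *
      ((r a.1 : ℂ) * freqAmplitude Q B s f a) =
      ((r a.1 * weight s x.2.2 a.1 : ℝ) : ℂ) * (symbol Q B a.1 a.2 x.1 x.2.1 * f a.2) := by
    intro a
    rw [mul_left_comm, exp_exponent_mul_freqAmplitude]
    push_cast
    ring
  have hint' := hint.congr (ae_of_all _ he)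
  rw [freqMeasure] at hint'
  have hin : ∀ τ ∈ Ioi (0 : ℝ), ofC (∫ v : Freq N, ((r τ * weight s x.2.2 τ : ℝ) : ℂ) *
      (symbol Q B τ v x.1 x.2.1 * f v)) =
      (r τ * weight s x.2.2 τ) • evolutiveSemigroup Q B τ u x.1 x.2.1 := by
    intro τ hτ
    rw [evolutiveSemigroup_eq hfm hf hτ (hK τ hτ), integral_const_mul, ← map_smul,
      Complex.real_smul]
  refine ⟨?_, ?_⟩
  · exact ((ofC (𝕜 := 𝕜)).integrable_comp hint'.integral_prod_left).congr
      ((ae_restrict_iff' measurableSet_Ioi).2 (ae_of_all _ hin))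
  · rw [expIntegral, integral_congr_ae (ae_of_all _ he), freqMeasure, integral_prod _ hint',
      ← ContinuousLinearMap.integral_comp_comm (ofC (𝕜 := 𝕜)) hint'.integral_prod_left]
    exact setIntegral_congr_fun measurableSet_Ioi hin

/-- The superposition of elementary solutions representing the extension. -/
def superposition (B : Matrix (Fin N) (Fin N) ℝ) (k : ℝ × Freq N → ℂ) (X : Space N)
    (t w : ℝ) : ℂ :=
  expIntegral (freqMeasure N) (exponent N) (freqExponent B) k (X, t, w)

end Extension

/-! ### Derivatives of the extension and the extension equation -/

section Extension

variable {N : ℕ} {𝕜 : Type*} [RCLike 𝕜] {Q B : Matrix (Fin N) (Fin N) ℝ}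

/-- The upper half-space. -/
def upper (N : ℕ) : Set (Space N × ℝ × ℝ) := {x | 0 < x.2.2}

lemma isOpen_upper : IsOpen (upper N) := isOpen_lt continuous_const (by fun_prop)

/-- Differentiation of a superposition in the direction `h`. -/
def ampDeriv (B : Matrix (Fin N) (Fin N) ℝ) (h : Space N × ℝ × ℝ) (k : ℝ × Freq N → ℂ) :
    ℝ × Freq N → ℂ :=
  fun a => exponent N (freqExponent B a) h * k a

/-- Amplitudes whose superpositions are smooth in the upper half-space. -/
def Admissible (B : Matrix (Fin N) (Fin N) ℝ) (k : ℝ × Freq N → ℂ) : Prop :=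
  ExpIntegrable (freqMeasure N) (exponent N) (freqExponent B) (upper N) k

variable {k : ℝ × Freq N → ℂ}

lemma Admissible.ampDeriv (hk : Admissible B k) (h : Space N × ℝ × ℝ) :
    Admissible B (ampDeriv B h k) :=
  ExpIntegrable.mul hk h

/-- Stated as an equality of functions, so that it can be used again for second derivatives; the
real-linear `ofC` commutes with differentiation. -/
lemma Admissible.partialDeriv (hk : Admissible B k) {w : ℝ} (hw : 0 < w) (c : ℝ) (i : Fin N)
    (t : ℝ) :
    partialDeriv i (fun X => (ofC (c • superposition B k X t w) : 𝕜)) =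
      fun X => ofC (c • superposition B
        (Hormander.ampDeriv B (EuclideanSpace.single i 1, 0, 0) k) X t w) := by
  ext1 X
  have hγ : HasDerivAt (fun r : ℝ => ((X + r • EuclideanSpace.single i 1, t, w) : Space N × ℝ × ℝ))
      (EuclideanSpace.single i 1, 0, 0) 0 := by
    refine HasDerivAt.prodMk ?_ (hasDerivAt_const _ _)
    simpa using ((hasDerivAt_id (0 : ℝ)).smul_const (EuclideanSpace.single i (1 : ℝ))).const_add X
  have h := ExpIntegrable.hasDerivAt_line hk (x := (X, t, w)) hw hγ (by simp)
  have h' : HasDerivAt (fun r : ℝ => (ofC (c • superposition B k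
      (X + r • EuclideanSpace.single i 1) t w) : 𝕜)) _ 0 :=
    (ofC (𝕜 := 𝕜)).hasFDerivAt.comp_hasDerivAt (0 : ℝ) (h.const_smul c)
  exact h'.deriv

lemma Admissible.hasDerivAt_time (hk : Admissible B k) {w : ℝ} (hw : 0 < w)
    (X : Space N) (t : ℝ) :
    HasDerivAt (fun t => superposition B k X t w)
      (superposition B (Hormander.ampDeriv B (0, 1, 0) k) X t w) t := by
  have hγ : HasDerivAt (fun t : ℝ => ((X, t, w) : Space N × ℝ × ℝ)) (0, 1, 0) t :=
    (hasDerivAt_const _ _).prodMk ((hasDerivAt_id t).prodMk (hasDerivAt_const _ _))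
  exact ExpIntegrable.hasDerivAt_line hk (x := (X, t, w)) hw hγ rfl

lemma Admissible.hasDerivAt_extra (hk : Admissible B k) {z : ℝ} (hz : 0 < z)
    (X : Space N) (t : ℝ) :
    HasDerivAt (fun z => superposition B k X t (z ^ 2 / 4))
      ((z / 2) • superposition B (Hormander.ampDeriv B (0, 0, 1) k) X t (z ^ 2 / 4)) z := by
  have hw : 0 < z ^ 2 / 4 := by positivity
  have hγ : HasDerivAt (fun w : ℝ => ((X, t, w) : Space N × ℝ × ℝ)) (0, 0, 1) (z ^ 2 / 4) :=
    (hasDerivAt_const _ _).prodMk ((hasDerivAt_const _ _).prodMk (hasDerivAt_id _))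
  have h : HasDerivAt (fun w => superposition B k X t w)
      (superposition B (Hormander.ampDeriv B (0, 0, 1) k) X t (z ^ 2 / 4)) (z ^ 2 / 4) :=
    ExpIntegrable.hasDerivAt_line hk (x := (X, t, z ^ 2 / 4)) hw hγ rfl
  have hz2 : HasDerivAt (fun z : ℝ => z ^ 2 / 4) (z / 2) z := by
    refine ((hasDerivAt_pow 2 z).div_const 4).congr_deriv ?_
    push_cast
    ring
  exact HasDerivAt.scomp z h hz2

lemma Admissible.contDiffOn (hk : Admissible B k) :
    ContDiffOn ℝ ∞ (fun x : Space N × ℝ × ℝ => superposition B k x.1 x.2.1 x.2.2) (upper N) :=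
  ExpIntegrable.contDiffOn isOpen_upper hk

lemma admissible_freqAmplitude (hQ : Q.PosSemidef) (hK : (covariance Q B 1).PosDef) {s : ℝ}
    (hs : 0 < s) {f : Freq N → ℂ} (hf : HasMoments f) : Admissible B (freqAmplitude Q B s f) :=
  expIntegrable_freq hQ hK hs hf

lemma ofC_superposition (hQ : Q.PosSemidef) (hK : ∀ t : ℝ, 0 < t → (covariance Q B t).PosDef)
    {u : 𝓢(Space N × ℝ, 𝕜)} {f : Freq N → ℂ} (hfm : HasMoments f)
    (hf : ∀ Y r, u (Y, r) = ofC (∫ v : Freq N, wave v Y r * f v)) {s : ℝ} (hs : 0 < s)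
    (X : Space N) (t : ℝ) {w : ℝ} (hw : 0 < w) :
    IntegrableOn (fun τ => weight s w τ • evolutiveSemigroup Q B τ u X t) (Ioi 0) ∧
    ofC (superposition B (freqAmplitude Q B s f) X t w) =
      ∫ τ in Ioi (0 : ℝ), weight s w τ • evolutiveSemigroup Q B τ u X t := by
  have hk := admissible_freqAmplitude hQ (hK 1 one_pos) hs hfm
  have h := ofC_expIntegral hK hfm hf s (x := (X, t, w)) (fun _ => 1)
    (by simpa using ExpIntegrable.integrable hk (x := (X, t, w)) hw)
  simpa [superposition] using h

/-- Differentiating in `w` brings down `-1/τ`; the Neumann data are expressed through this integral.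
-/
lemma ofC_superposition_extra (hQ : Q.PosSemidef)
    (hK : ∀ t : ℝ, 0 < t → (covariance Q B t).PosDef)
    {u : 𝓢(Space N × ℝ, 𝕜)} {f : Freq N → ℂ} (hfm : HasMoments f)
    (hf : ∀ Y r, u (Y, r) = ofC (∫ v : Freq N, wave v Y r * f v)) {s : ℝ} (hs : 0 < s)
    (X : Space N) (t : ℝ) {w : ℝ} (hw : 0 < w) :
    IntegrableOn (fun τ => (-τ⁻¹ * weight s w τ) • evolutiveSemigroup Q B τ u X t) (Ioi 0) ∧
    ofC (superposition B (ampDeriv B (0, 0, 1) (freqAmplitude Q B s f)) X t w) =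
      ∫ τ in Ioi (0 : ℝ), (-τ⁻¹ * weight s w τ) • evolutiveSemigroup Q B τ u X t := by
  have hk := (admissible_freqAmplitude hQ (hK 1 one_pos) hs hfm).ampDeriv (0, 0, 1)
  have he : ampDeriv B (0, 0, 1) (freqAmplitude Q B s f) =
      fun a => ((-a.1⁻¹ : ℝ) : ℂ) * freqAmplitude Q B s f a := by
    ext a
    rw [ampDeriv, exponent_extra, freqExponent]
    push_cast
    ring
  rw [he] at hk ⊢
  exact ofC_expIntegral hK hfm hf s (x := (X, t, w)) (fun τ => -τ⁻¹)
    (ExpIntegrable.integrable hk (x := (X, t, w)) hw)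

/-- The extension as a superposition of elementary solutions. -/
lemma extension_eq_superposition (hQ : Q.PosSemidef)
    (hK : ∀ t : ℝ, 0 < t → (covariance Q B t).PosDef)
    {u : 𝓢(Space N × ℝ, 𝕜)} {f : Freq N → ℂ} (hfm : HasMoments f)
    (hf : ∀ Y r, u (Y, r) = ofC (∫ v : Freq N, wave v Y r * f v)) {s : ℝ} (hs : 0 < s)
    (X : Space N) (t : ℝ) {z : ℝ} (hz : 0 < z) :
    extension Q B (1 - 2 * s) u X t z =
      ofC ((besselConst s * z ^ (2 * s)) •
        superposition B (freqAmplitude Q B s f) X t (z ^ 2 / 4)) := by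
  rw [extension_eq_semigroup, map_smul, (ofC_superposition hQ hK hfm hf hs X t
    (by positivity : 0 < z ^ 2 / 4)).2, ← integral_smul]
  refine setIntegral_congr_fun measurableSet_Ioi fun τ hτ => ?_
  rw [besselKernel_eq z hτ, smul_smul]

lemma contDiffOn_extension (hQ : Q.PosSemidef)
    (hK : ∀ t : ℝ, 0 < t → (covariance Q B t).PosDef) (u : 𝓢(Space N × ℝ, 𝕜)) {s : ℝ}
    (hs : 0 < s) :
    ContDiffOn ℝ ∞ (fun x : Space N × ℝ × ℝ => extension Q B (1 - 2 * s) u x.1 x.2.1 x.2.2)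
      (upper N) := by
  obtain ⟨f, hfm, hf⟩ := exists_fourier_repr u
  have hk := admissible_freqAmplitude hQ (hK 1 one_pos) hs hfm
  refine ContDiffOn.congr (f := fun x : Space N × ℝ × ℝ =>
    (ofC ((besselConst s * x.2.2 ^ (2 * s)) •
      superposition B (freqAmplitude Q B s f) x.1 x.2.1 (x.2.2 ^ 2 / 4)) : 𝕜)) ?_
    fun x hx => extension_eq_superposition hQ hK hfm hf hs x.1 x.2.1 hx
  have h0 : ContDiffOn ℝ ∞ (fun x : Space N × ℝ × ℝ => besselConst s * x.2.2 ^ (2 * s))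
      (upper N) := by
    refine contDiffOn_const.mul (ContDiffOn.rpow_const_of_ne (by fun_prop) fun x hx => ?_)
    exact ne_of_gt hx
  have h1 : ContDiffOn ℝ ∞ (fun x : Space N × ℝ × ℝ => (x.1, x.2.1, x.2.2 ^ 2 / 4)) (upper N) := by
    fun_prop
  have h2 := hk.contDiffOn.comp h1 fun x hx => by
    have : 0 < x.2.2 := hx
    change 0 < x.2.2 ^ 2 / 4
    positivity
  exact (ofC (𝕜 := 𝕜)).contDiff.comp_contDiffOn (h0.smul h2)

/-- The first `z`-derivative of the extension. -/
lemma hasDerivAt_extension (hQ : Q.PosSemidef)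
    (hK : ∀ t : ℝ, 0 < t → (covariance Q B t).PosDef)
    {u : 𝓢(Space N × ℝ, 𝕜)} {f : Freq N → ℂ} (hfm : HasMoments f)
    (hf : ∀ Y r, u (Y, r) = ofC (∫ v : Freq N, wave v Y r * f v)) {s : ℝ} (hs : 0 < s)
    (X : Space N) (t : ℝ) {z : ℝ} (hz : 0 < z) :
    HasDerivAt (fun z => extension Q B (1 - 2 * s) u X t z)
      (ofC ((besselConst s * (2 * s * z ^ (2 * s - 1))) •
          superposition B (freqAmplitude Q B s f) X t (z ^ 2 / 4) +
        (besselConst s * (z ^ (2 * s + 1) / 2)) •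
          superposition B (ampDeriv B (0, 0, 1) (freqAmplitude Q B s f)) X t (z ^ 2 / 4))) z := by
  have hk := admissible_freqAmplitude hQ (hK 1 one_pos) hs hfm
  have hr : HasDerivAt (fun z : ℝ => besselConst s * z ^ (2 * s))
      (besselConst s * (2 * s * z ^ (2 * s - 1))) z :=
    (Real.hasDerivAt_rpow_const (Or.inl hz.ne')).const_mul _
  have h := (ofC (𝕜 := 𝕜)).hasFDerivAt.comp_hasDerivAt z (hr.smul (hk.hasDerivAt_extra hz X t))
  refine (h.congr_of_eventuallyEq ?_).congr_deriv ?_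
  · filter_upwards [lt_mem_nhds hz] with z' hz'
    exact extension_eq_superposition hQ hK hfm hf hs X t hz'
  · congr 1
    rw [add_comm, smul_smul, Real.rpow_add_one hz.ne']
    congr 2
    ring

/-- The Bessel operator acting on the extension. -/
lemma besselOp_extension (hQ : Q.PosSemidef)
    (hK : ∀ t : ℝ, 0 < t → (covariance Q B t).PosDef)
    {u : 𝓢(Space N × ℝ, 𝕜)} {f : Freq N → ℂ} (hfm : HasMoments f)
    (hf : ∀ Y r, u (Y, r) = ofC (∫ v : Freq N, wave v Y r * f v)) {s : ℝ} (hs : 0 < s)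
    (X : Space N) (t : ℝ) {z : ℝ} (hz : 0 < z) :
    besselOp (1 - 2 * s) (fun z => extension Q B (1 - 2 * s) u X t z) z =
      ofC ((besselConst s * z ^ (2 * s)) • ((((z ^ 2 / 4 : ℝ) : ℂ) *
          superposition B (ampDeriv B (0, 0, 1) (ampDeriv B (0, 0, 1)
            (freqAmplitude Q B s f))) X t (z ^ 2 / 4)) +
        ((s + 1 : ℝ) : ℂ) *
          superposition B (ampDeriv B (0, 0, 1) (freqAmplitude Q B s f)) X t (z ^ 2 / 4))) := by
  have hk := admissible_freqAmplitude hQ (hK 1 one_pos) hs hfm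
  have hd : ∀ z', 0 < z' → deriv (fun z => extension Q B (1 - 2 * s) u X t z) z' = _ :=
    fun z' hz' => (hasDerivAt_extension hQ hK hfm hf hs X t hz').deriv
  have hr1 : HasDerivAt (fun z : ℝ => besselConst s * (2 * s * z ^ (2 * s - 1)))
      (besselConst s * (2 * s * ((2 * s - 1) * z ^ (2 * s - 1 - 1)))) z :=
    ((Real.hasDerivAt_rpow_const (Or.inl hz.ne')).const_mul _).const_mul _
  have hr2 : HasDerivAt (fun z : ℝ => besselConst s * (z ^ (2 * s + 1) / 2))
      (besselConst s * ((2 * s + 1) * z ^ (2 * s + 1 - 1) / 2)) z :=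
    ((Real.hasDerivAt_rpow_const (Or.inl hz.ne')).div_const _).const_mul _
  have h := (ofC (𝕜 := 𝕜)).hasFDerivAt.comp_hasDerivAt z
    ((hr1.smul (hk.hasDerivAt_extra hz X t)).add
      (hr2.smul ((hk.ampDeriv (0, 0, 1)).hasDerivAt_extra hz X t)))
  have h2 := (h.congr_of_eventuallyEq (f₁ := deriv fun z => extension Q B (1 - 2 * s) u X t z) (by
    filter_upwards [lt_mem_nhds hz] with z' hz'
    exact hd z' hz')).deriv
  rw [besselOp, h2, hd z hz, ← map_smul, ← map_add]
  congr 1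
  simp only [Complex.real_smul]
  -- All powers are written through `z^{2s}`. The undifferentiated terms cancel since `2s(2s-1) +
  -- (1-2s)2s = 0`, and the first-order ones add up to `2s + 1/2 + (1-2s)/2 = s + 1`.
  have e1 : z ^ (2 * s - 1 - 1) = z ^ (2 * s) / z / z := by
    rw [Real.rpow_sub_one hz.ne', Real.rpow_sub_one hz.ne']
  rw [e1, Real.rpow_sub_one hz.ne', add_sub_cancel_right, Real.rpow_add_one hz.ne']
  have hzc : (z : ℂ) ≠ 0 := by exact_mod_cast hz.ne'
  push_cast
  field_simp
  ring

lemma extensionOp_extension (hQ : Q.PosSemidef)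
    (hK : ∀ t : ℝ, 0 < t → (covariance Q B t).PosDef) (u : 𝓢(Space N × ℝ, 𝕜)) {s : ℝ}
    (hs : 0 < s) (X : Space N) (t : ℝ) {z : ℝ} (hz : 0 < z) :
    extensionOp Q B (1 - 2 * s) (extension Q B (1 - 2 * s) u) X t z = 0 := by
  obtain ⟨f, hfm, hf⟩ := exists_fourier_repr u
  have hk := admissible_freqAmplitude hQ (hK 1 one_pos) hs hfm
  have hw : 0 < z ^ 2 / 4 := by positivity
  set c := besselConst s * z ^ (2 * s) with hc
  set k := freqAmplitude Q B s f with hkdef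
  have hX : ∀ X' t', extension Q B (1 - 2 * s) u X' t' z =
      ofC (c • superposition B k X' t' (z ^ 2 / 4)) :=
    fun X' t' => extension_eq_superposition hQ hK hfm hf hs X' t' hz
  have ht : deriv (fun t' => (ofC (c • superposition B k X t' (z ^ 2 / 4)) : 𝕜)) t =
      ofC (c • superposition B (ampDeriv B (0, 1, 0) k) X t (z ^ 2 / 4)) :=
    ((ofC (𝕜 := 𝕜)).hasFDerivAt.comp_hasDerivAt t
      ((hk.hasDerivAt_time hw X t).const_smul c)).deriv
  rw [extensionOp, hormanderOp, besselOp_extension hQ hK hfm hf hs X t hz]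
  simp only [hX, diffusionOp]
  rw [ht]
  simp only [hk.partialDeriv hw, (hk.ampDeriv _).partialDeriv hw]
  simp only [← map_smul, ← map_sum, ← map_add, ← map_sub]
  have heq := expIntegral_equation hQ (hK 1 one_pos) hs hfm (x := (X, t, z ^ 2 / 4)) hw rfl rfl rfl
  rw [← map_zero (ofC (𝕜 := 𝕜))]
  congr 1
  refine Eq.trans ?_ ((congrArg (fun y : ℂ => z ^ (1 - 2 * s) • c • y) heq).trans (by simp))
  simp only [smul_add, smul_sub, Finset.smul_sum, ← Complex.real_smul]
  refine congrArg₂ (· + ·) (congrArg₂ (· - ·) (congrArg₂ (· + ·) ?_ ?_) rfl) rfl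
  · refine Finset.sum_congr rfl fun i _ => Finset.sum_congr rfl fun j _ => ?_
    rw [smul_comm (Q i j) c]; rfl
  · refine Finset.sum_congr rfl fun i _ => ?_
    rw [smul_comm _ c]; rfl

end Extension

/-! ### Joint measurability and absolute convergence -/

section Measurability

variable {N : ℕ} {𝕜 : Type*} [RCLike 𝕜] {Q B : Matrix (Fin N) (Fin N) ℝ}

lemma measurable_det {α : Type*} [MeasurableSpace α] {A : α → Matrix (Fin N) (Fin N) ℝ}
    (hA : ∀ i j, Measurable fun x => A x i j) : Measurable fun x => (A x).det := by
  simp_rw [Matrix.det_apply']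
  exact Finset.measurable_sum _ fun σ _ => measurable_const.mul
    (Finset.measurable_prod _ fun i _ => hA _ _)

/-- The adjugate formula, with the convention `0⁻¹ = 0`, covers singular matrices too, so no
restriction to `t > 0` is needed. -/
lemma measurable_inv_apply {α : Type*} [MeasurableSpace α] {A : α → Matrix (Fin N) (Fin N) ℝ}
    (hA : ∀ i j, Measurable fun x => A x i j) (i j : Fin N) : Measurable fun x => (A x)⁻¹ i j := by
  simp_rw [Matrix.inv_def, Ring.inverse_eq_inv', Matrix.smul_apply, Matrix.adjugate_apply,
    smul_eq_mul]
  refine (measurable_det hA).inv.mul (measurable_det fun i' j' => ?_)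
  simp_rw [Matrix.updateRow_apply]
  split_ifs
  · exact measurable_const
  · exact hA _ _

lemma measurable_kernel (X : Space N) :
    Measurable fun q : Space N × ℝ => kernel Q B X q.1 q.2 := by
  have hcov (i j : Fin N) : Measurable fun q : Space N × ℝ => covariance Q B q.2 i j := by
    have h : Continuous fun t : ℝ => ∫ σ in (0 : ℝ)..t,
        (NormedSpace.exp (σ • B) * Q * NormedSpace.exp (σ • Bᵀ)) i j :=
      intervalIntegral.continuous_primitive
        (fun a b => ((continuous_expConj Q B).matrix_elem i j).intervalIntegrable a b) 0
    have h' : Measurable fun t : ℝ => covariance Q B t i j :=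
      (measurable_const.div measurable_id).mul h.measurable
    exact h'.comp measurable_snd
  have hdet : Measurable fun q : Space N × ℝ => (q.2 • covariance Q B q.2).det :=
    measurable_det fun i j => measurable_snd.mul (hcov i j)
  have hvec (i : Fin N) : Measurable fun q : Space N × ℝ =>
      (q.1.ofLp - NormedSpace.exp (q.2 • B) *ᵥ X.ofLp) i := by
    have h1 : Continuous fun q : Space N × ℝ => NormedSpace.exp (q.2 • B) *ᵥ X.ofLp :=
      ((continuous_exp_smul B).comp continuous_snd).matrix_mulVec continuous_const
    have h2 : Continuous fun q : Space N × ℝ =>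
        q.1.ofLp - NormedSpace.exp (q.2 • B) *ᵥ X.ofLp := by fun_prop
    exact ((continuous_apply i).comp h2).measurable
  unfold kernel
  simp only [dotProduct, Matrix.mulVec] at hvec ⊢
  refine (measurable_const.mul (hdet.pow_const _)).mul (Measurable.exp ?_)
  refine Measurable.div (Measurable.neg ?_) (measurable_const.mul measurable_snd)
  exact Finset.measurable_sum _ fun i _ => (Finset.measurable_sum _ fun j _ =>
    (measurable_inv_apply hcov i j).mul (hvec j)).mul (hvec i)

lemma measurable_besselKernel (a z : ℝ) : Measurable fun τ => besselKernel a z τ := by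
  unfold besselKernel
  fun_prop

lemma measurable_poissonKernel (Q B : Matrix (Fin N) (Fin N) ℝ) (a z : ℝ) (X : Space N) (t : ℝ) :
    Measurable fun q : Space N × ℝ => poissonKernel Q B a z X q.1 (t - q.2) := by
  have h : Measurable fun q : Space N × ℝ => poissonKernel Q B a z X q.1 q.2 :=
    ((measurable_besselKernel a z).comp measurable_snd).mul (measurable_kernel (Q := Q) (B := B) X)
  have h1 : Measurable fun q : Space N × ℝ => (q.1, t - q.2) :=
    measurable_fst.prodMk (measurable_const.sub measurable_snd)
  generalize poissonKernel Q B a z X = F at h ⊢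
  exact h.comp h1

lemma integrable_kernel_smul (u : 𝓢(Space N × ℝ, 𝕜)) (X : Space N) (r : ℝ) {τ : ℝ} (hτ : 0 < τ)
    (hK : (covariance Q B τ).PosDef) :
    Integrable fun Y : Space N => kernel Q B X Y τ • u (Y, r) := by
  obtain ⟨C, hC, hu⟩ := exists_norm_schwartz_le u
  refine ((integrable_kernel hτ hK X).mul_const C).mono' ?_ (ae_of_all _ fun Y => ?_)
  · exact ((continuous_kernel τ X).smul
      (u.continuous.comp (by fun_prop : Continuous fun Y : Space N => (Y, r)))).aestronglyMeasurable
  · rw [norm_smul, Real.norm_of_nonneg (kernel_nonneg hτ hK X Y)]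
    exact mul_le_mul_of_nonneg_left (hu _) (kernel_nonneg hτ hK X Y)

lemma integrableOn_besselKernel {s z : ℝ} (hs : 0 < s) (hz : 0 < z) :
    IntegrableOn (fun τ => besselKernel (1 - 2 * s) z τ) (Ioi 0) := by
  have h : IntegrableOn (fun τ => besselConst s * z ^ (2 * s) * weight s (z ^ 2 / 4) τ) (Ioi 0) :=
    (integrableOn_weight hs (by positivity : 0 < z ^ 2 / 4)).const_mul _
  exact h.congr_fun (fun τ hτ => (besselKernel_eq z hτ).symm) measurableSet_Ioi

lemma besselKernel_nonneg {s z τ : ℝ} (hs : 0 < s) (hz : 0 < z) (hτ : 0 < τ) :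
    0 ≤ besselKernel (1 - 2 * s) z τ := by
  rw [besselKernel_eq z hτ]
  have := besselConst_pos hs
  have := weight_nonneg s (z ^ 2 / 4) hτ
  positivity

/-- Absolute convergence of the double integral defining the extension. -/
lemma integrableOn_poissonKernel_smul (hK : ∀ t : ℝ, 0 < t → (covariance Q B t).PosDef)
    (u : 𝓢(Space N × ℝ, 𝕜)) {s z : ℝ} (hs : 0 < s) (hz : 0 < z) (X : Space N) (t : ℝ) :
    IntegrableOn (fun q : Space N × ℝ =>
      poissonKernel Q B (1 - 2 * s) z X q.1 (t - q.2) • u q) {q | q.2 < t} := by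
  obtain ⟨C, hC, hu⟩ := exists_norm_schwartz_le u
  have hset : {q : Space N × ℝ | q.2 < t} = univ ×ˢ Iio t := by ext q; simp
  rw [IntegrableOn, hset, Measure.volume_eq_prod, ← Measure.prod_restrict, Measure.restrict_univ]
  have hmeas := measurable_poissonKernel Q B (1 - 2 * s) z X t
  have hmeas' : AEStronglyMeasurable (fun q : Space N × ℝ =>
      poissonKernel Q B (1 - 2 * s) z X q.1 (t - q.2) • u q)
      ((volume : Measure (Space N)).prod (volume.restrict (Iio t))) :=
    hmeas.aestronglyMeasurable.smul u.continuous.aestronglyMeasurable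
  -- Tonelli: the kernel has mass one in `Y`, so the norm of the integrand integrates in `Y` to at
  -- most `C g^{(a)}(z, t-τ)`, which is integrable in `τ`.
  refine (integrable_prod_iff' hmeas').2 ⟨?_, ?_⟩
  · filter_upwards [ae_restrict_mem measurableSet_Iio] with τ hτ
    have h := (integrable_kernel_smul u X τ (sub_pos.2 hτ) (hK _ (sub_pos.2 hτ))).smul
      (besselKernel (1 - 2 * s) z (t - τ))
    refine h.congr (ae_of_all _ fun Y => ?_)
    simp [poissonKernel, mul_smul]
  · have hb : Integrable (fun τ => besselKernel (1 - 2 * s) z (t - τ) * C)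
        (volume.restrict (Iio t)) :=
      ((measurePreserving_restrict_sub_left t).integrable_comp_emb
        (measurableEmbedding_sub_left t)).2 (integrableOn_besselKernel hs hz) |>.mul_const C
    refine hb.mono' hmeas'.norm.prod_swap.integral_prod_right' ?_
    filter_upwards [ae_restrict_mem measurableSet_Iio] with τ hτ
    have hτ' : 0 < t - τ := sub_pos.2 hτ
    rw [Real.norm_of_nonneg (integral_nonneg fun Y => norm_nonneg _)]
    have h1 : ∫ Y, besselKernel (1 - 2 * s) z (t - τ) * C * kernel Q B X Y (t - τ) =
        besselKernel (1 - 2 * s) z (t - τ) * C := by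
      rw [integral_const_mul, integral_kernel hτ' (hK _ hτ'), mul_one]
    rw [← h1]
    refine integral_mono_of_nonneg (ae_of_all _ fun Y => norm_nonneg _)
      ((integrable_kernel hτ' (hK _ hτ') X).const_mul _) (ae_of_all _ fun Y => ?_)
    have hk0 := kernel_nonneg hτ' (hK _ hτ') X Y
    have hb0 := besselKernel_nonneg hs hz hτ'
    simp only [poissonKernel]
    rw [norm_smul, norm_mul, Real.norm_of_nonneg hb0, Real.norm_of_nonneg hk0]
    calc _ ≤ besselKernel (1 - 2 * s) z (t - τ) * kernel Q B X Y (t - τ) * C := by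
          gcongr; exact hu _
      _ = _ := by ring

end Measurability

/-! ### Boundary behaviour as `z → 0⁺` -/

section Boundary

variable {N : ℕ} {𝕜 : Type*} [RCLike 𝕜] {Q B : Matrix (Fin N) (Fin N) ℝ} {s : ℝ}

lemma tendsto_eLpNorm_top {F : ℝ → Space N × ℝ → 𝕜} {b : ℝ → ℝ}
    (hF : ∀ z, 0 < z → ∀ q, ‖F z q‖ ≤ b z) (hb : Tendsto b (𝓝[>] 0) (𝓝 0)) :
    Tendsto (fun z => eLpNorm (F z) ∞ volume) (𝓝[>] 0) (𝓝 0) := by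
  have h := ENNReal.tendsto_ofReal hb
  rw [ENNReal.ofReal_zero] at h
  refine tendsto_of_tendsto_of_tendsto_of_le_of_le' tendsto_const_nhds h
    (Eventually.of_forall fun _ => zero_le) ?_
  filter_upwards [self_mem_nhdsWithin] with z hz
  rw [eLpNorm_exponent_top]
  exact eLpNormEssSup_le_of_ae_bound (ae_of_all _ (hF z hz))

/-- The relative weight of the extension. -/
def dirichletWeight (s z τ : ℝ) : ℝ := besselConst s * z ^ (2 * s) * Real.exp (-(z ^ 2 / 4 / τ))

/-- The relative weight of the normal derivative. -/
def neumannWeight (s z τ : ℝ) : ℝ :=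
  (1 - z ^ 2 / 4 / τ / s) * Real.exp (-(z ^ 2 / 4 / τ))

lemma measurable_dirichletWeight (s z : ℝ) : Measurable (dirichletWeight s z) := by
  unfold dirichletWeight; fun_prop

lemma measurable_neumannWeight (s z : ℝ) : Measurable (neumannWeight s z) := by
  unfold neumannWeight; fun_prop

lemma exp_neg_div_le_one (z : ℝ) {τ : ℝ} (hτ : 0 < τ) : Real.exp (-(z ^ 2 / 4 / τ)) ≤ 1 := by
  rw [Real.exp_le_one_iff]
  have : 0 ≤ z ^ 2 / 4 / τ := by positivity
  linarith

lemma abs_dirichletWeight_le (hs : 0 < s) {z : ℝ} (hz : 0 < z) {τ : ℝ} (hτ : 0 < τ) :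
    |dirichletWeight s z τ| ≤ besselConst s * z ^ (2 * s) := by
  have hb := besselConst_pos hs
  rw [dirichletWeight, abs_of_nonneg (by positivity)]
  exact mul_le_of_le_one_right (by positivity) (exp_neg_div_le_one z hτ)

/-- Because `xe^{-x} ≤ 1` for `x = z²/(4τ)`, the bound is uniform in both `z` and `τ`, as dominated
convergence requires. -/
lemma abs_neumannWeight_le (hs : 0 < s) (z : ℝ) {τ : ℝ} (hτ : 0 < τ) :
    |neumannWeight s z τ| ≤ 1 + 1 / s := by
  set x := z ^ 2 / 4 / τ with hx
  have hx0 : 0 ≤ x := by positivity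
  have h1 : Real.exp (-x) ≤ 1 := exp_neg_div_le_one z hτ
  have h2 : x * Real.exp (-x) ≤ 1 := by
    rw [Real.exp_neg, ← div_eq_mul_inv, div_le_one (Real.exp_pos _)]
    linarith [Real.add_one_le_exp x]
  rw [neumannWeight, abs_mul, Real.abs_exp]
  calc _ ≤ (1 + x / s) * Real.exp (-x) := by
        gcongr
        have : 0 ≤ x / s := by positivity
        rw [abs_le]
        constructor <;> linarith
    _ = Real.exp (-x) + x * Real.exp (-x) / s := by ring
    _ ≤ 1 + 1 / s := by gcongr

lemma tendsto_neumannWeight (s : ℝ) (τ : ℝ) :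
    Tendsto (fun z => neumannWeight s z τ) (𝓝[>] 0) (𝓝 1) := by
  have h : Continuous fun z => neumannWeight s z τ := by
    unfold neumannWeight; fun_prop
  have h0 := h.tendsto 0
  have he : neumannWeight s 0 τ = 1 := by simp [neumannWeight]
  rw [he] at h0
  exact h0.mono_left nhdsWithin_le_nhds

/-- After the uniform estimate of `P_τ u - u`, the whole Neumann limit rests on this scalar
dominated convergence. -/
lemma tendsto_integral_neumannWeight (hs0 : 0 < s) (hs1 : s < 1) :
    Tendsto (fun z => ∫ τ in Ioi (0 : ℝ), majorant s τ * |neumannWeight s z τ - 1|) (𝓝[>] 0)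
      (𝓝 0) := by
  have h := tendsto_integral_filter_of_dominated_convergence (μ := volume.restrict (Ioi (0 : ℝ)))
    (l := 𝓝[>] (0 : ℝ)) (F := fun z τ => majorant s τ * |neumannWeight s z τ - 1|)
    (f := fun _ => 0) (fun τ => majorant s τ * (1 + 1 / s + 1)) ?_ ?_ ?_ ?_
  · simpa using h
  · exact Eventually.of_forall fun z => (integrableOn_majorant hs0 hs1).aestronglyMeasurable.mul
      ((measurable_neumannWeight s z).sub_const 1).abs.aestronglyMeasurable
  · refine Eventually.of_forall fun z => ?_
    filter_upwards [ae_restrict_mem measurableSet_Ioi] with τ hτ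
    have hm := majorant_nonneg s hτ
    rw [Real.norm_of_nonneg (by positivity)]
    gcongr
    refine (abs_sub _ _).trans ?_
    rw [abs_one]
    gcongr
    exact abs_neumannWeight_le hs0 z hτ
  · exact (integrableOn_majorant hs0 hs1).mul_const _
  · refine ae_of_all _ fun τ => ?_
    have h1 := (((tendsto_neumannWeight s τ).sub_const 1).abs).const_mul (majorant s τ)
    simpa using h1

/-- Unit mass of the Bessel kernel lets `u` be moved inside the `τ`-integral. -/
lemma extension_sub_eq (hQ : Q.PosSemidef) (hK : ∀ t : ℝ, 0 < t → (covariance Q B t).PosDef)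
    {u : 𝓢(Space N × ℝ, 𝕜)} {f : Freq N → ℂ} (hfm : HasMoments f)
    (hf : ∀ Y r, u (Y, r) = ofC (∫ v : Freq N, wave v Y r * f v)) (hs : 0 < s) {z : ℝ} (hz : 0 < z)
    (q : Space N × ℝ) :
    extension Q B (1 - 2 * s) u q.1 q.2 z - u q =
      ∫ τ in Ioi (0 : ℝ), (τ ^ (-1 - s) * dirichletWeight s z τ) •
        (evolutiveSemigroup Q B τ u q.1 q.2 - u q) := by
  have hw : 0 < z ^ 2 / 4 := by positivity
  obtain ⟨hi, he⟩ := ofC_superposition hQ hK hfm hf hs q.1 q.2 hw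
  rw [extension_eq_superposition hQ hK hfm hf hs q.1 q.2 hz, map_smul, he]
  have h1 : ∀ τ, (τ ^ (-1 - s) * dirichletWeight s z τ) •
      (evolutiveSemigroup Q B τ u q.1 q.2 - u q) = (besselConst s * z ^ (2 * s)) •
      (weight s (z ^ 2 / 4) τ • evolutiveSemigroup Q B τ u q.1 q.2 -
        weight s (z ^ 2 / 4) τ • u q) := by
    intro τ
    rw [← smul_sub, smul_smul, dirichletWeight, weight]
    congr 1
    ring
  simp_rw [h1]
  rw [integral_smul, integral_sub hi ((integrableOn_weight hs hw).smul_const _),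
    integral_smul_const, integral_weight hs hw, smul_sub, smul_smul (besselConst s * z ^ (2 * s)),
    besselConst_mul_rpow_mul hs hz, one_smul]

/-- The normalisation of the Neumann data is chosen so that the constant in Balakrishnan's formula
comes out exactly. -/
lemma neumannConst_mul (hs0 : 0 < s) (hs1 : s < 1) :
    (2 : ℝ) ^ (-(1 - 2 * s)) * Real.Gamma ((1 - (1 - 2 * s)) / 2) /
      Real.Gamma ((1 + (1 - 2 * s)) / 2) * (besselConst s * (2 * s)) =
      s / Real.Gamma (1 - s) := by
  have h1 := Real.Gamma_pos_of_pos hs0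
  have h2 := Real.Gamma_pos_of_pos (sub_pos.2 hs1)
  rw [besselConst, show (1 - (1 - 2 * s)) / 2 = s by ring,
    show (1 + (1 - 2 * s)) / 2 = 1 - s by ring, show -(1 - 2 * s) = 2 * s - 1 by ring,
    Real.rpow_sub_one (by norm_num)]
  have h3 : 0 < (2 : ℝ) ^ (2 * s) := by positivity
  field_simp

/-- The derivatives of `z^{2s}` and of `e^{-z²/(4τ)}` combine into one weight proportional to `1 -
z²/(4τs)`. It has mass zero against `τ^{-1-s}e^{-z²/(4τ)}`, so `u` can be subtracted freely. -/
lemma neumannData_eq (hQ : Q.PosSemidef) (hK : ∀ t : ℝ, 0 < t → (covariance Q B t).PosDef)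
    {u : 𝓢(Space N × ℝ, 𝕜)} {f : Freq N → ℂ} (hfm : HasMoments f)
    (hf : ∀ Y r, u (Y, r) = ofC (∫ v : Freq N, wave v Y r * f v)) (hs0 : 0 < s) (hs1 : s < 1)
    {z : ℝ} (hz : 0 < z) (q : Space N × ℝ) :
    neumannData (1 - 2 * s) (extension Q B (1 - 2 * s) u) q.1 q.2 z =
      (-(s / Real.Gamma (1 - s))) • ∫ τ in Ioi (0 : ℝ), (τ ^ (-1 - s) * neumannWeight s z τ) •
        (evolutiveSemigroup Q B τ u q.1 q.2 - u q) := by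
  have hw : 0 < z ^ 2 / 4 := by positivity
  obtain ⟨hi, he⟩ := ofC_superposition hQ hK hfm hf hs0 q.1 q.2 hw
  obtain ⟨hi', he'⟩ := ofC_superposition_extra hQ hK hfm hf hs0 q.1 q.2 hw
  have hwi := integrableOn_weight hs0 hw
  have hwi' : IntegrableOn (fun τ => -τ⁻¹ * weight s (z ^ 2 / 4) τ) (Ioi 0) := by
    refine (integrableOn_weight (by linarith : 0 < s + 1) hw).neg.congr_fun (fun τ hτ => ?_)
      measurableSet_Ioi
    simp [weight_add_one s _ hτ]
  -- The mass-zero property; it makes the two contributions of `u` cancel below.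
  have hzero : (∫ τ in Ioi (0 : ℝ), weight s (z ^ 2 / 4) τ) +
      z ^ 2 / 4 / s * (∫ τ in Ioi (0 : ℝ), -τ⁻¹ * weight s (z ^ 2 / 4) τ) = 0 := by
    have h1 : ∫ τ in Ioi (0 : ℝ), -τ⁻¹ * weight s (z ^ 2 / 4) τ =
        -∫ τ in Ioi (0 : ℝ), weight (s + 1) (z ^ 2 / 4) τ := by
      rw [← integral_neg]
      refine setIntegral_congr_fun measurableSet_Ioi fun τ hτ => ?_
      simp [weight_add_one s _ hτ]
    have h2 := integral_weight_add_one hs0 hw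
    rw [h1]
    field_simp
    field_simp at h2
    linarith
  have h1 : ∀ τ, (τ ^ (-1 - s) * neumannWeight s z τ) •
      (evolutiveSemigroup Q B τ u q.1 q.2 - u q) =
      (weight s (z ^ 2 / 4) τ • evolutiveSemigroup Q B τ u q.1 q.2 -
        weight s (z ^ 2 / 4) τ • u q) + (z ^ 2 / 4 / s) •
      ((-τ⁻¹ * weight s (z ^ 2 / 4) τ) • evolutiveSemigroup Q B τ u q.1 q.2 -
        (-τ⁻¹ * weight s (z ^ 2 / 4) τ) • u q) := by
    intro τ
    rw [← smul_sub, ← smul_sub, smul_smul, ← add_smul, neumannWeight, weight]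
    congr 1
    field_simp
    ring
  have h2 : ∫ τ in Ioi (0 : ℝ), (τ ^ (-1 - s) * neumannWeight s z τ) •
      (evolutiveSemigroup Q B τ u q.1 q.2 - u q) =
      (∫ τ in Ioi (0 : ℝ), weight s (z ^ 2 / 4) τ • evolutiveSemigroup Q B τ u q.1 q.2) +
      (z ^ 2 / 4 / s) • ∫ τ in Ioi (0 : ℝ),
        (-τ⁻¹ * weight s (z ^ 2 / 4) τ) • evolutiveSemigroup Q B τ u q.1 q.2 := by
    have hA : IntegrableOn (fun τ => weight s (z ^ 2 / 4) τ • evolutiveSemigroup Q B τ u q.1 q.2 -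
        weight s (z ^ 2 / 4) τ • u q) (Ioi 0) := hi.sub (hwi.smul_const _)
    have hB' : IntegrableOn (fun τ =>
        (-τ⁻¹ * weight s (z ^ 2 / 4) τ) • evolutiveSemigroup Q B τ u q.1 q.2 -
          (-τ⁻¹ * weight s (z ^ 2 / 4) τ) • u q) (Ioi 0) := hi'.sub (hwi'.smul_const _)
    have hB : IntegrableOn (fun τ => (z ^ 2 / 4 / s) •
        ((-τ⁻¹ * weight s (z ^ 2 / 4) τ) • evolutiveSemigroup Q B τ u q.1 q.2 -
          (-τ⁻¹ * weight s (z ^ 2 / 4) τ) • u q)) (Ioi 0) :=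
      Integrable.fun_smul (z ^ 2 / 4 / s) hB'
    simp_rw [h1]
    rw [integral_add hA hB, integral_sub hi (hwi.smul_const _), integral_smul, integral_sub hi' (hwi'.smul_const _),
      integral_smul_const, integral_smul_const, smul_sub, smul_smul _ _ (u q)]
    rw [show ∀ a b c d : 𝕜, a - b + (c - d) = a + c - (b + d) by intros; ring, ← add_smul, hzero,
      zero_smul, sub_zero]
  rw [h2, neumannData, (hasDerivAt_extension hQ hK hfm hf hs0 q.1 q.2 hz).deriv, map_add, map_smul,
    map_smul, he, he', ← neumannConst_mul hs0 hs1, smul_add, smul_add, smul_smul, smul_smul,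
    smul_smul]
  -- The factor `z^a` cancels the power from differentiating `z^{2s}` and turns the other term into
  -- `z²/2`, that is `2w`.
  have e1 : z ^ (1 - 2 * s) * z ^ (2 * s - 1) = 1 := by
    rw [← Real.rpow_add hz]; norm_num
  have e2 : z ^ (1 - 2 * s) * z ^ (2 * s + 1) = z ^ 2 := by
    rw [← Real.rpow_add hz, show 1 - 2 * s + (2 * s + 1) = 2 by ring, Real.rpow_two]
  congr 2
  · linear_combination (-((2 : ℝ) ^ (-(1 - 2 * s)) * Real.Gamma ((1 - (1 - 2 * s)) / 2) /
      Real.Gamma ((1 + (1 - 2 * s)) / 2)) * besselConst s * (2 * s)) * e1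
  · have e3 : z ^ 2 / 4 / s * (2 * s) = z ^ 2 / 2 := by field_simp; norm_num
    linear_combination (-((2 : ℝ) ^ (-(1 - 2 * s)) * Real.Gamma ((1 - (1 - 2 * s)) / 2) /
      Real.Gamma ((1 + (1 - 2 * s)) / 2)) * besselConst s) * (e2 / 2 - e3)

end Boundary

end Hormander

end

/-! ### Assembly -/

theorem theorem4p1 {𝕜 : Type*} [RCLike 𝕜] {N : ℕ}
    (Q B : Matrix (Fin N) (Fin N) ℝ) (hQ : Q.PosSemidef)
    (hK : ∀ t : ℝ, 0 < t → (Hormander.covariance Q B t).PosDef)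
    (s a : ℝ) (hs0 : 0 < s) (hs1 : s < 1) (ha : a = 1 - 2 * s)
    (u : 𝓢(EuclideanSpace ℝ (Fin N) × ℝ, 𝕜)) :
    -- the double integral defining `U` converges absolutely, and `τ ↦ t - τ` may be substituted
    (∀ (X : EuclideanSpace ℝ (Fin N)) (t z : ℝ), 0 < z →
      IntegrableOn (fun q : EuclideanSpace ℝ (Fin N) × ℝ =>
        Hormander.poissonKernel Q B a z X q.1 (t - q.2) • u q) {q | q.2 < t} ∧
      Hormander.extension Q B a u X t z =
        ∫ τ in Ioi (0 : ℝ), ∫ Y : EuclideanSpace ℝ (Fin N),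
          Hormander.poissonKernel Q B a z X Y τ • u (Y, t - τ)) ∧
    -- the integrals defining `P^𝒦_τ u` and `(-𝒦)^s u` converge absolutely
    (∀ (X : EuclideanSpace ℝ (Fin N)) (t τ : ℝ), 0 < τ →
      Integrable (fun Y : EuclideanSpace ℝ (Fin N) =>
        Hormander.kernel Q B X Y τ • u (Y, t - τ))) ∧
    (∀ (X : EuclideanSpace ℝ (Fin N)) (t : ℝ),
      IntegrableOn (fun τ : ℝ =>
        τ ^ (-1 - s) • (Hormander.evolutiveSemigroup Q B τ u X t - u (X, t))) (Ioi 0)) ∧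
    -- `U` is smooth on `ℝ^{N+1} × (0,∞)`
    ContDiffOn ℝ ∞ (fun q : EuclideanSpace ℝ (Fin N) × ℝ × ℝ =>
      Hormander.extension Q B a u q.1 q.2.1 q.2.2) {q | 0 < q.2.2} ∧
    -- `𝒦_a U = 0`
    (∀ (X : EuclideanSpace ℝ (Fin N)) (t z : ℝ), 0 < z →
      Hormander.extensionOp Q B a (Hormander.extension Q B a u) X t z = 0) ∧
    -- `U(·,·,z) → u` in `L^∞(ℝ^{N+1})`
    (∀ z : ℝ, 0 < z →
      MemLp (fun q : EuclideanSpace ℝ (Fin N) × ℝ =>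
        Hormander.extension Q B a u q.1 q.2 z) ∞ volume) ∧
    Tendsto (fun z : ℝ =>
      eLpNorm (fun q : EuclideanSpace ℝ (Fin N) × ℝ =>
        Hormander.extension Q B a u q.1 q.2 z - u q) ∞ volume) (𝓝[>] 0) (𝓝 0) ∧
    -- the weighted Neumann data converge to `(-𝒦)^s u` in `L^∞(ℝ^{N+1})`
    MemLp (fun q : EuclideanSpace ℝ (Fin N) × ℝ =>
      Hormander.fracPower Q B s u q.1 q.2) ∞ volume ∧
    (∀ z : ℝ, 0 < z →
      MemLp (fun q : EuclideanSpace ℝ (Fin N) × ℝ =>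
        Hormander.neumannData a (Hormander.extension Q B a u) q.1 q.2 z) ∞ volume) ∧
    Tendsto (fun z : ℝ =>
      eLpNorm (fun q : EuclideanSpace ℝ (Fin N) × ℝ =>
        Hormander.neumannData a (Hormander.extension Q B a u) q.1 q.2 z -
          Hormander.fracPower Q B s u q.1 q.2) ∞ volume) (𝓝[>] 0) (𝓝 0) := by
  subst ha
  obtain ⟨f, hfm, hf⟩ := Hormander.exists_fourier_repr u
  obtain ⟨C, hC, hT⟩ := Hormander.exists_norm_semigroup_sub_le hQ hK u hfm hf
  obtain ⟨M, hM, hu⟩ := Hormander.exists_norm_schwartz_le u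
  have hT' : ∀ τ, 0 < τ → ∀ q : EuclideanSpace ℝ (Fin N) × ℝ,
      ‖Hormander.evolutiveSemigroup Q B τ u q.1 q.2 - u q‖ ≤ C * min τ 1 :=
    fun τ hτ q => hT τ hτ q.1 q.2
  have hTm : ∀ q : EuclideanSpace ℝ (Fin N) × ℝ, AEStronglyMeasurable
      (fun τ => Hormander.evolutiveSemigroup Q B τ u q.1 q.2) (volume.restrict (Ioi 0)) :=
    fun q => Hormander.aestronglyMeasurable_semigroup hK u hfm hf q.1 q.2
  have hTc : ∀ τ, 0 < τ → Continuous fun q : EuclideanSpace ℝ (Fin N) × ℝ =>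
      Hormander.evolutiveSemigroup Q B τ u q.1 q.2 :=
    fun τ hτ => Hormander.continuous_semigroup hQ hK u hfm hf hτ
  have hone : ∀ τ : ℝ, 0 < τ → |(1 : ℝ)| ≤ 1 := fun _ _ => abs_one.le
  have hmemLp : ∀ (w : ℝ → ℝ) (K : ℝ), Measurable w → (∀ τ, 0 < τ → |w τ| ≤ K) →
      MemLp (fun q : EuclideanSpace ℝ (Fin N) × ℝ => ∫ τ in Ioi (0 : ℝ), (τ ^ (-1 - s) * w τ) •
        (Hormander.evolutiveSemigroup Q B τ u q.1 q.2 - u q)) ∞ volume := fun w K hw hwK =>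
    memLp_top_of_bound
      (Hormander.continuous_weighted hs0 hs1 hw hwK hT' hTm hTc u.continuous).aestronglyMeasurable
      _ (ae_of_all _ (Hormander.norm_integral_weighted_le hs0 hs1 hw hwK hT'))
  -- The fractional power is the weighted average with constant weight `1`, so the same lemmas cover
  -- it.
  have hfrac : ∀ q : EuclideanSpace ℝ (Fin N) × ℝ, Hormander.fracPower Q B s u q.1 q.2 =
      (-(s / Real.Gamma (1 - s))) • ∫ τ in Ioi (0 : ℝ), (τ ^ (-1 - s) * 1) •
        (Hormander.evolutiveSemigroup Q B τ u q.1 q.2 - u q) := fun q => by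
    simp only [mul_one]; rfl
  refine ⟨fun X t z hz => ⟨Hormander.integrableOn_poissonKernel_smul hK u hs0 hz X t,
      Hormander.extension_eq_integral_Ioi _ u X t z⟩,
    fun X t τ hτ => Hormander.integrable_kernel_smul u X (t - τ) hτ (hK τ hτ), fun X t => ?_,
    Hormander.contDiffOn_extension hQ hK u hs0,
    fun X t z hz => Hormander.extensionOp_extension hQ hK u hs0 X t hz, fun z hz => ?_, ?_, ?_,
    fun z hz => ?_, ?_⟩
  · simpa only [mul_one] using Hormander.integrableOn_weighted hs0 hs1 measurable_const hone hT'
      (hTm (X, t))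
  -- Boundedness of `U` follows from `U = (U - u) + u`.
  · have h := (hmemLp (Hormander.dirichletWeight s z) _ (Hormander.measurable_dirichletWeight s z)
      fun τ hτ => Hormander.abs_dirichletWeight_le hs0 hz hτ).add
      (memLp_top_of_bound (μ := volume) u.continuous.aestronglyMeasurable M (ae_of_all _ hu))
    refine h.ae_eq (ae_of_all _ fun q => ?_)
    simp only [Pi.add_apply]
    rw [← Hormander.extension_sub_eq hQ hK hfm hf hs0 hz q, sub_add_cancel]
  · refine Hormander.tendsto_eLpNorm_top (b := fun z => C * (Hormander.besselConst s * z ^ (2 * s) *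
      ∫ τ in Ioi (0 : ℝ), Hormander.majorant s τ)) (fun z hz q => ?_) ?_
    · have hw := fun τ hτ => Hormander.abs_dirichletWeight_le (τ := τ) hs0 hz hτ
      rw [Hormander.extension_sub_eq hQ hK hfm hf hs0 hz q]
      refine (Hormander.norm_integral_weighted_le hs0 hs1 (Hormander.measurable_dirichletWeight s z)
        hw hT' q).trans (mul_le_mul_of_nonneg_left ?_ hC)
      rw [← integral_const_mul]
      refine setIntegral_mono_on (Hormander.integrableOn_majorant_mul hs0 hs1
        (Hormander.measurable_dirichletWeight s z) hw)
        ((Hormander.integrableOn_majorant hs0 hs1).const_mul _) measurableSet_Ioi fun τ hτ => ?_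
      rw [mul_comm]
      exact mul_le_mul_of_nonneg_right (hw τ hτ) (Hormander.majorant_nonneg s hτ)
    · have h : Continuous fun z : ℝ => C * (Hormander.besselConst s * z ^ (2 * s) *
          ∫ τ in Ioi (0 : ℝ), Hormander.majorant s τ) :=
        continuous_const.mul ((continuous_const.mul
          (Real.continuous_rpow_const (by positivity))).mul continuous_const)
      have h0 := h.tendsto 0
      -- The bound is a multiple of `z^{2s}`, continuous with value `0` at `z = 0` because `s > 0`.
      rw [Real.zero_rpow (by positivity), mul_zero, zero_mul, mul_zero] at h0
      exact h0.mono_left nhdsWithin_le_nhds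
  · simp only [hfrac]
    exact (hmemLp (fun _ => 1) 1 measurable_const hone).const_smul (-(s / Real.Gamma (1 - s)))
  · simp only [Hormander.neumannData_eq hQ hK hfm hf hs0 hs1 hz]
    exact (hmemLp _ _ (Hormander.measurable_neumannWeight s z)
      fun τ hτ => Hormander.abs_neumannWeight_le hs0 z hτ).const_smul (-(s / Real.Gamma (1 - s)))
  · have hlim := ((Hormander.tendsto_integral_neumannWeight hs0 hs1).const_mul C).const_mul
      |-(s / Real.Gamma (1 - s))|
    rw [mul_zero, mul_zero] at hlim
    refine Hormander.tendsto_eLpNorm_top (fun z hz q => ?_) hlim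
    have hm := Hormander.measurable_neumannWeight s z
    have hw := fun τ hτ => Hormander.abs_neumannWeight_le (τ := τ) hs0 z hτ
    have hw1 : ∀ τ : ℝ, 0 < τ → |Hormander.neumannWeight s z τ - 1| ≤ 1 + 1 / s + 1 := fun τ hτ =>
      (abs_sub _ _).trans (add_le_add (hw τ hτ) abs_one.le)
    -- The difference is again a weighted average of `P_τ u - u`, now with weight `neumannWeight -
    -- 1`.
    rw [Hormander.neumannData_eq hQ hK hfm hf hs0 hs1 hz, hfrac, ← smul_sub,
      ← integral_sub (Hormander.integrableOn_weighted hs0 hs1 hm hw hT' (hTm q))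
        (Hormander.integrableOn_weighted hs0 hs1 measurable_const hone hT' (hTm q)), norm_smul,
      Real.norm_eq_abs]
    simp only [← sub_smul, ← mul_sub]
    exact mul_le_mul_of_nonneg_left (Hormander.norm_integral_weighted_le hs0 hs1
      (hm.sub_const 1) hw1 hT' q) (abs_nonneg _)
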